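/- **Setting.** Let $\Sigma$ be the hexagonal lattice drawn as a brick wall: vertices $\mathbb{Z}^2$, horizontal unit edges, vertical unit edges going up from the $(i,j)$ with $i+j$ even; its faces are the bricks $[i,i+2]\times[j,j+1]$ with $i+j$ even, each with six boundary vertices $\partial f$, coloured green, red, blue according to $i \bmod 3 = 0,1,2$ (adjacent faces have different colours). A qubit sits on each vertex. For $\Lambda\subset\mathbb{Z}^2$ let $\mathcal A(\Lambda)$ be the $C^*$-algebra $\overline{\bigcup_{\Lambda'\subset\Lambda\text{ finite}}\bigotimes_{v\in\Lambda'}M_2(\mathbb{C})}$, and $\mathcal A=\mathcal A(\mathbb{Z}^2)$. Put $K_f=\bigotimes_{v\in\partial f}\sigma^{\mathtt x}_v$, $J_f=\bigotimes_{v\in\partial f}\sigma^{\mathtt z}_v$, and let $\omega_0$ be the ground state of the color code, i.e. the unique state on $\mathcal A$ with $\omega_0(K_f)=\omega_0(J_f)=1$ for all faces $f$; let $\pi_0$ be a GNS representation of $\omega_0$. A cone is a set of vertices $\{x\in\mathbb{Z}^2: (x-p)\cdot a>\|x-p\|\cos\theta\}$ with $p,a\in\mathbb{R}^2$, $\|a\|=1$,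 $\theta\in(0,\pi)$. A representation $\pi$ of $\mathcal A$ is a superselection sector if $\pi|_{\mathcal A(\Lambda^c)}\simeq\pi_0|_{\mathcal A(\Lambda^c)}$ (unitary equivalence) for every cone $\Lambda$. For a colour $c\in\{\mathtt r,\mathtt g,\mathtt b\}$, a half-infinite string of colour $c$ is a sequence $\gamma=(f_0,v_0,v_1,f_1,v_2,v_3,f_2,\dots)$ of faces $f_n$ of colour $c$ and pairwise distinct vertices $v_m$ such that $v_{2n}\in\partial f_n$ and $v_{2n+1}\in\partial f_{n+1}$ are joined by an edge and $f_n\ne f_{n+1}$. With $\gamma_n=\{v_0,\dots,v_{2n-1}\}$ put $S^{c\mathtt x}_{\gamma_n}=\bigotimes_{v\in\gamma_n}\sigma^{\mathtt x}_v$, $S^{c\mathtt z}_{\gamma_n}=\bigotimes_{v\in\gamma_n}\sigma^{\mathtt z}_v$, $S^{c\mathtt y}_{\gamma_n}=S^{c\mathtt x}_{\gamma_n}S^{c\mathtt z}_{\gamma_n}$, and for $k\in\{\mathtt x,\mathtt y,\mathtt z\}$ define the endomorphism $\rho^{ck}_\gamma(A)=\lim_n (S^{ck}_{\gamma_n})^\dagger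 A\,S^{ck}_{\gamma_n}$ of $\mathcal A$. Let $\pi^{ck}$ be a GNS representation of $\omega_0\circ\rho^{ck}_\gamma$ for some half-infinite string $\gamma$ of colour $c$ contained in a cone. Let $\gamma_{\mathtt g},\gamma_{\mathtt r},\gamma_{\mathtt b}$ be the vertical half-infinite strings going up from the mutually adjacent faces with lower left corners $(0,0)$, $(1,-1)$, $(2,0)$; let $\pi^{ck,c'k'}$ be a GNS representation of $\omega_0\circ\rho^{ck}_{\gamma_c}\circ\rho^{c'k'}_{\gamma_{c'}}$ and put $$\pi^{\mathtt f_1}=\pi^{\mathtt{rx},\mathtt{bz}},\ \pi^{\mathtt f_2}=\pi^{\mathtt{rz},\mathtt{bx}},\ \pi^{\mathtt f_3}=\pi^{\mathtt{bz},\mathtt{gy}},\ \pi^{\mathtt f_4}=\pi^{\mathtt{rz},\mathtt{gy}},\ \pi^{\mathtt f_5}=\pi^{\mathtt{rx},\mathtt{gy}},\ \pi^{\mathtt f_6}=\pi^{\mathtt{bx},\mathtt{gy}}.$$ The tensor product of endomorphisms is $(\rho\otimes\rho')(A)=\rho(\rho'(A))$. A relation $\pi\simeq\pi^{ck}\otimes\pi^{c'k'}$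 means: for all half-infinite strings $\gamma,\gamma'$ of colours $c,c'$, each contained in some cone, $\pi^{ck}\simeq\pi_0\circ\rho^{ck}_\gamma$, $\pi^{c'k'}\simeq\pi_0\circ\rho^{c'k'}_{\gamma'}$ and $\pi\simeq\pi_0\circ(\rho^{ck}_\gamma\otimes\rho^{c'k'}_{\gamma'})$. **Proposition.** The representations $\pi^{ck}$ ($c\in\{\mathtt r,\mathtt g,\mathtt b\}$, $k\in\{\mathtt x,\mathtt y,\mathtt z\}$) and $\pi^{\mathtt f_j}$ ($1\le j\le 6$) are superselection sectors, and they obey the following fusion relations: $$\begin{aligned} &\pi^{\mathtt f_1}\simeq\pi^{\mathtt{rx}}\otimes\pi^{\mathtt{bz}}\simeq\pi^{\mathtt{ry}}\otimes\pi^{\mathtt{gz}}\simeq\pi^{\mathtt{gx}}\otimes\pi^{\mathtt{by}},\\ &\pi^{\mathtt f_2}\simeq\pi^{\mathtt{rz}}\otimes\pi^{\mathtt{bx}}\simeq\pi^{\mathtt{ry}}\otimes\pi^{\mathtt{gx}}\simeq\pi^{\mathtt{gz}}\otimes\pi^{\mathtt{by}},\\ &\pi^{\mathtt f_3}\simeq\pi^{\mathtt{bz}}\otimes\pi^{\mathtt{gy}}\simeq\pi^{\mathtt{gx}}\otimes\pi^{\mathtt{rz}}\simeq\pi^{\mathtt{bx}}\otimes\pi^{\mathtt{ry}},\\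 &\pi^{\mathtt f_4}\simeq\pi^{\mathtt{rz}}\otimes\pi^{\mathtt{gy}}\simeq\pi^{\mathtt{gx}}\otimes\pi^{\mathtt{bz}}\simeq\pi^{\mathtt{rx}}\otimes\pi^{\mathtt{by}},\\ &\pi^{\mathtt f_5}\simeq\pi^{\mathtt{rx}}\otimes\pi^{\mathtt{gy}}\simeq\pi^{\mathtt{bx}}\otimes\pi^{\mathtt{gz}}\simeq\pi^{\mathtt{by}}\otimes\pi^{\mathtt{rz}},\\ &\pi^{\mathtt f_6}\simeq\pi^{\mathtt{bx}}\otimes\pi^{\mathtt{gy}}\simeq\pi^{\mathtt{rx}}\otimes\pi^{\mathtt{gz}}\simeq\pi^{\mathtt{ry}}\otimes\pi^{\mathtt{bz}}. \end{aligned}$$ -/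

import Mathlib

open Filter Topology
open scoped symmDiff ComplexOrder

universe u v w

noncomputable section

namespace ColorCode

/-! ### The coloured brick-wall lattice -/

/-- The three colours red, green, blue. -/
inductive Color
  | r | g | b

/-- The three Pauli types. -/
inductive PauliType
  | x | y | z

/-- Vertices of the (brick-wall drawing of the) hexagonal lattice: the integer points of the
plane. One qubit sits on each vertex. -/
abbrev Vertex : Type := ℤ × ℤ

/-- The edges: all horizontal unit segments, and the vertical unit segments going up from the
vertices `(i, j)` with `i + j` even. Every vertex has exactly three neighbours. -/
def lattice : SimpleGraph Vertex :=
  SimpleGraph.fromRel fun u v =>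
    v = (u.1 + 1, u.2) ∨ (Even (u.1 + u.2) ∧ v = (u.1, u.2 + 1))

/-- The faces: the bricks `[i, i + 2] × [j, j + 1]` with `i + j` even, given by their lower left
corner `(i, j)`. -/
def Face : Type := {p : ℤ × ℤ // Even (p.1 + p.2)}

/-- The six vertices of a face. -/
def Face.boundary (f : Face) : Finset Vertex :=
  Finset.Icc f.1.1 (f.1.1 + 2) ×ˢ Finset.Icc f.1.2 (f.1.2 + 1)

/-- The colour of a face; any two adjacent faces have different colours. -/
def Face.color (f : Face) : Color :=
  if f.1.1 % 3 = 0 then .g else if f.1.1 % 3 = 1 then .r else .b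

/-- The position of a vertex in the Euclidean plane. -/
def Vertex.pos (v : Vertex) : EuclideanSpace ℝ (Fin 2) := !₂[(v.1 : ℝ), (v.2 : ℝ)]

/-- Cones: the sets of vertices in `{x | (x - p) · a > ‖x - p‖ cos θ}`, with apex `p`, axis the
unit vector `a` and half-opening angle `θ ∈ (0, π)`. -/
def IsCone (Λ : Set Vertex) : Prop :=
  ∃ (p a : EuclideanSpace ℝ (Fin 2)) (θ : ℝ), ‖a‖ = 1 ∧ 0 < θ ∧ θ < Real.pi ∧
    Λ = {v | ‖Vertex.pos v - p‖ * Real.cos θ < inner ℝ (Vertex.pos v - p) a}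

/-! ### Pauli operators -/

/-- The space `ℓ²` with orthonormal basis `|t⟩`, `t` a finite set of vertices. It is the infinite
tensor product of copies of `ℂ²` along the unit vectors `|0⟩`: the vector `|t⟩` has `|1⟩` at the
vertices of `t` and `|0⟩` elsewhere. It only serves to realise the quasi-local algebra. -/
abbrev Conf : Type := lp (fun _ : Finset Vertex => ℂ) 2

/-- The isometry `ψ ↦ (t ↦ φ t * ψ (e t))`. -/
def phasePerm (e : Equiv.Perm (Finset Vertex)) (φ : Finset Vertex → ℂ) (hφ : ∀ t, ‖φ t‖ = 1) :
    Conf →ₗᵢ[ℂ] Conf where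
  toFun ψ := ⟨fun t => φ t * ψ (e t), by
    have h := lp.memℓp ψ
    have h2 : 0 < (2 : ENNReal).toReal := by norm_num
    refine (memℓp_gen_iff h2).2 ?_
    have := (memℓp_gen_iff h2).1 h
    simpa [hφ, Function.comp_def] using (e.summable_iff.2 this)⟩
  map_add' ψ χ := by
    ext t
    exact mul_add (φ t) (ψ (e t)) (χ (e t))
  map_smul' c ψ := by
    ext t
    simp [mul_left_comm]
  norm_map' ψ := by
    have h2 : 0 < (2 : ENNReal).toReal := by norm_num
    rw [lp.norm_eq_tsum_rpow h2, lp.norm_eq_tsum_rpow h2]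
    congr 1
    simpa [hφ] using e.tsum_eq (fun t => ‖ψ t‖ ^ (2 : ℝ))

theorem phasePerm_apply (e : Equiv.Perm (Finset Vertex)) (φ : Finset Vertex → ℂ)
    (hφ : ∀ t, ‖φ t‖ = 1) (ψ : Conf) (t : Finset Vertex) :
    phasePerm e φ hφ ψ t = φ t * ψ (e t) := rfl

/-- `⊗_{v ∈ s} σ_v^x`, that is `|t⟩ ↦ |s ∆ t⟩`. -/
def pauliX (s : Finset Vertex) : Conf →L[ℂ] Conf :=
  (phasePerm (Function.Involutive.toPerm (fun t => s ∆ t) (fun t => symmDiff_symmDiff_cancel_left s t))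
    (fun _ => 1) (fun _ => by simp)).toContinuousLinearMap

/-- `⊗_{v ∈ s} σ_v^z`, that is `|t⟩ ↦ (-1)^{|s ∩ t|} |t⟩`. -/
def pauliZ (s : Finset Vertex) : Conf →L[ℂ] Conf :=
  (phasePerm (Equiv.refl _) (fun t => (-1) ^ (s ∩ t).card) (fun _ => by simp)).toContinuousLinearMap

theorem pauliX_apply (s : Finset Vertex) (ψ : Conf) (t : Finset Vertex) :
    pauliX s ψ t = ψ (s ∆ t) := by
  change (1 : ℂ) * ψ (s ∆ t) = _
  rw [one_mul]

theorem pauliZ_apply (s : Finset Vertex) (ψ : Conf) (t : Finset Vertex) :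
    pauliZ s ψ t = (-1) ^ (s ∩ t).card * ψ t := rfl

theorem pauliX_mul (s t : Finset Vertex) : pauliX s * pauliX t = pauliX (s ∆ t) := by
  ext ψ u
  simp only [mul_apply_eq_comp, pauliX_apply]
  rw [← symmDiff_assoc, symmDiff_comm t s]

theorem neg_one_pow_symmDiff (a b : Finset Vertex) :
    (-1 : ℂ) ^ (a ∆ b).card = (-1) ^ a.card * (-1) ^ b.card := by
  have h1 : (a ∆ b).card + 2 * (a ∩ b).card = a.card + b.card := by
    have e1 := Finset.card_sdiff_add_card_inter a b
    have e2 := Finset.card_sdiff_add_card_inter b a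
    have e3 : (a ∆ b).card = (a \ b).card + (b \ a).card := by
      rw [symmDiff_def, Finset.sup_eq_union, Finset.card_union_of_disjoint disjoint_sdiff_sdiff]
    rw [Finset.inter_comm b a] at e2
    omega
  rw [← pow_add, ← h1, pow_add, pow_mul]
  simp

theorem pauliZ_mul (s t : Finset Vertex) : pauliZ s * pauliZ t = pauliZ (s ∆ t) := by
  ext ψ u
  simp only [mul_apply_eq_comp, pauliZ_apply]
  have : (s ∆ t) ∩ u = (s ∩ u) ∆ (t ∩ u) := by
    ext x; simp only [Finset.mem_inter, Finset.mem_symmDiff]; tauto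
  rw [this, neg_one_pow_symmDiff, mul_assoc]

theorem pauliZ_mul_pauliX (s t : Finset Vertex) :
    pauliZ s * pauliX t = (-1 : ℂ) ^ (s ∩ t).card • (pauliX t * pauliZ s) := by
  ext ψ u
  simp only [mul_apply_eq_comp, smul_apply, lp.coeFn_smul,
    Pi.smul_apply, pauliZ_apply, pauliX_apply, smul_eq_mul]
  have : s ∩ (t ∆ u) = (s ∩ t) ∆ (s ∩ u) := by
    ext x; simp only [Finset.mem_inter, Finset.mem_symmDiff]; tauto
  rw [this, neg_one_pow_symmDiff, ← mul_assoc, ← mul_assoc, ← pow_add, ← two_mul, pow_mul]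
  simp

theorem pauliX_empty : pauliX ∅ = 1 := by
  ext ψ u
  rw [pauliX_apply, ← Finset.bot_eq_empty, bot_symmDiff]
  rfl

theorem pauliZ_empty : pauliZ ∅ = 1 := by
  ext ψ u
  simp [pauliZ_apply]

theorem star_pauliX (s : Finset Vertex) : star (pauliX s) = pauliX s := by
  have h : star (pauliX s) * pauliX s = 1 := by
    rw [ContinuousLinearMap.star_eq_adjoint]
    exact (ContinuousLinearMap.norm_map_iff_adjoint_comp_self _).1
      (fun ψ => LinearIsometry.norm_map _ ψ)
  calc star (pauliX s) = star (pauliX s) * (pauliX s * pauliX s) := by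
        rw [pauliX_mul, symmDiff_self, Finset.bot_eq_empty, pauliX_empty, mul_one]
    _ = pauliX s := by rw [← mul_assoc, h, one_mul]

theorem star_pauliZ (s : Finset Vertex) : star (pauliZ s) = pauliZ s := by
  have h : star (pauliZ s) * pauliZ s = 1 := by
    rw [ContinuousLinearMap.star_eq_adjoint]
    exact (ContinuousLinearMap.norm_map_iff_adjoint_comp_self _).1
      (fun ψ => LinearIsometry.norm_map _ ψ)
  calc star (pauliZ s) = star (pauliZ s) * (pauliZ s * pauliZ s) := by
        rw [pauliZ_mul, symmDiff_self, Finset.bot_eq_empty, pauliZ_empty, mul_one]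
    _ = pauliZ s := by rw [← mul_assoc, h, one_mul]

/-! ### The quasi-local algebra -/

/-- The algebra `𝒜(Λ)` of observables localised in `Λ`: the C⋆-algebra generated by the Pauli
matrices `σ_v^x`, `σ_v^z` at the vertices `v ∈ Λ`. As these generate the matrix algebra `M₂(ℂ)` of
the qubit at `v`, for finite `Λ` this is `⊗_{v ∈ Λ} M₂(ℂ)`, and for infinite `Λ` it is the norm
closure of the union of the algebras of the finite subsets of `Λ`. -/
def localAlgebra (Λ : Set Vertex) : StarSubalgebra ℂ (Conf →L[ℂ] Conf) :=
  (StarAlgebra.adjoin ℂ {T | ∃ v ∈ Λ, T = pauliX {v} ∨ T = pauliZ {v}}).topologicalClosure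

/-- The quasi-local algebra. -/
abbrev QLA : Type := localAlgebra Set.univ

instance isClosed_localAlgebra (Λ : Set Vertex) :
    IsClosed (localAlgebra Λ : Set (Conf →L[ℂ] Conf)) :=
  StarSubalgebra.isClosed_topologicalClosure _

instance : CompleteSpace QLA := (isClosed_localAlgebra Set.univ).completeSpace_coe

theorem singleX_mem {Λ : Set Vertex} {v : Vertex} (hv : v ∈ Λ) : pauliX {v} ∈ localAlgebra Λ :=
  StarSubalgebra.le_topologicalClosure _ (StarAlgebra.subset_adjoin ℂ _ ⟨v, hv, Or.inl rfl⟩)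

theorem singleZ_mem {Λ : Set Vertex} {v : Vertex} (hv : v ∈ Λ) : pauliZ {v} ∈ localAlgebra Λ :=
  StarSubalgebra.le_topologicalClosure _ (StarAlgebra.subset_adjoin ℂ _ ⟨v, hv, Or.inr rfl⟩)

theorem symmDiff_singleton {v : Vertex} {s : Finset Vertex} (h : v ∉ s) :
    ({v} : Finset Vertex) ∆ s = insert v s := by
  ext x
  simp only [Finset.mem_symmDiff, Finset.mem_singleton, Finset.mem_insert]
  constructor
  · tauto
  · rintro (rfl | hx)
    · exact Or.inl ⟨rfl, h⟩
    · exact Or.inr ⟨hx, fun e => h (e ▸ hx)⟩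

theorem pauliX_mem (s : Finset Vertex) : pauliX s ∈ localAlgebra Set.univ := by
  induction s using Finset.induction_on with
  | empty => rw [pauliX_empty]; exact one_mem _
  | insert v s hv ih =>
    rw [← symmDiff_singleton hv, ← pauliX_mul]
    exact mul_mem (singleX_mem (Set.mem_univ v)) ih

theorem pauliZ_mem (s : Finset Vertex) : pauliZ s ∈ localAlgebra Set.univ := by
  induction s using Finset.induction_on with
  | empty => rw [pauliZ_empty]; exact one_mem _
  | insert v s hv ih =>
    rw [← symmDiff_singleton hv, ← pauliZ_mul]
    exact mul_mem (singleZ_mem (Set.mem_univ v)) ih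

/-- `⊗_{v ∈ s} σ_v^x`, `⊗_{v ∈ s} σ_v^z` and their product `(⊗ σ_v^x) (⊗ σ_v^z)`, as elements of
the quasi-local algebra, for `k = x, z, y`. -/
def pauliString (k : PauliType) (s : Finset Vertex) : QLA :=
  match k with
  | .x => ⟨pauliX s, pauliX_mem s⟩
  | .z => ⟨pauliZ s, pauliZ_mem s⟩
  | .y => ⟨pauliX s, pauliX_mem s⟩ * ⟨pauliZ s, pauliZ_mem s⟩

/-- The stabilizer operator `K_f = ⊗_{v ∈ ∂f} σ_v^x`. -/
def stabK (f : Face) : QLA := pauliString .x f.boundary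

/-- The stabilizer operator `J_f = ⊗_{v ∈ ∂f} σ_v^z`. -/
def stabJ (f : Face) : QLA := pauliString .z f.boundary

/-! ### States and representations -/

/-- States on the quasi-local algebra: positive normalised linear functionals. -/
structure IsState (ω : QLA →ₗ[ℂ] ℂ) : Prop where
  nonneg : ∀ a, 0 ≤ ω (star a * a)
  map_one : ω 1 = 1

/-- The ground state condition: `ω` is a state with `ω(K_f) = ω(J_f) = 1` for all faces `f`.
This condition determines `ω` uniquely. -/
structure IsGroundState (ω : QLA →ₗ[ℂ] ℂ) : Prop extends IsState ω where
  map_stabK : ∀ f, ω (stabK f) = 1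
  map_stabJ : ∀ f, ω (stabJ f) = 1

theorem even_inter (f g : Face) : Even (f.boundary ∩ g.boundary).card := by
  obtain ⟨⟨i, j⟩, hf⟩ := f
  obtain ⟨⟨k, l⟩, hg⟩ := g
  have h : ∀ a b c d : ℤ, Finset.Icc a b ∩ Finset.Icc c d = Finset.Icc (max a c) (min b d) :=
    fun a b c d => by ext x; simp only [Finset.mem_inter, Finset.mem_Icc]; omega
  simp only [Face.boundary] at *
  rw [Finset.product_inter_product, Finset.card_product, h, h, Int.card_Icc, Int.card_Icc, Nat.even_mul]
  rw [Int.even_iff] at hf hg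
  rw [Nat.even_iff, Nat.even_iff]
  omega

/-- Every finite family of stabilizer conditions has a solution in `Conf`. -/
theorem exists_stabilized (F : Finset Face) : ∃ ψ : Conf,
    (∀ f ∈ F, pauliX f.boundary ψ = ψ) ∧ (∀ f : Face, pauliZ f.boundary ψ = ψ) ∧
      (∀ t, 0 ≤ ψ t) ∧ 0 < ψ ∅ := by
  classical
  induction F using Finset.induction_on with
  | empty =>
    refine ⟨lp.single 2 ∅ (1 : ℂ), by simp, fun f => ?_, fun t => ?_, ?_⟩
    · ext t
      rw [pauliZ_apply]
      by_cases ht : t = ∅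
      · subst ht; simp
      · rw [lp.single_apply_ne 2 _ _ ht, mul_zero]
    · by_cases ht : t = ∅
      · subst ht; rw [lp.single_apply_self]; exact zero_le_one
      · rw [lp.single_apply_ne 2 _ _ ht]
    · rw [lp.single_apply_self]; exact zero_lt_one
  | insert f F hf ih =>
    obtain ⟨ψ, hX, hZ, h0, h1⟩ := ih
    refine ⟨ψ + pauliX f.boundary ψ, fun g hg => ?_, fun g => ?_, fun t => ?_, ?_⟩
    · rcases Finset.mem_insert.1 hg with rfl | hg
      · rw [map_add, ← mul_apply_eq_comp, pauliX_mul, symmDiff_self, Finset.bot_eq_empty,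
          pauliX_empty, add_comm]
        rfl
      · rw [map_add, hX g hg, ← mul_apply_eq_comp, pauliX_mul, symmDiff_comm, ← pauliX_mul,
          mul_apply_eq_comp, hX g hg]
    · rw [map_add, hZ g, ← mul_apply_eq_comp, pauliZ_mul_pauliX, (even_inter g f).neg_one_pow,
        one_smul, mul_apply_eq_comp, hZ g]
    · exact add_nonneg (h0 t) (by rw [pauliX_apply]; exact h0 _)
    · exact add_pos_of_pos_of_nonneg h1 (by rw [pauliX_apply]; exact h0 _)

theorem exists_unit_stabilized (F : Finset Face) : ∃ ψ : Conf, ‖ψ‖ = 1 ∧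
    (∀ f ∈ F, pauliX f.boundary ψ = ψ) ∧ (∀ f : Face, pauliZ f.boundary ψ = ψ) := by
  obtain ⟨ψ, hX, hZ, -, h1⟩ := exists_stabilized F
  have hne : ψ ≠ 0 := by
    rintro rfl
    exact lt_irrefl _ h1
  refine ⟨((‖ψ‖ : ℂ)⁻¹) • ψ, ?_, fun f hf => ?_, fun f => ?_⟩
  · rw [norm_smul]
    simp [hne]
  · rw [map_smul, hX f hf]
  · rw [map_smul, hZ f]

/-- A limit point of the vector states of finite families of stabilizers is a ground state. -/
theorem exists_isGroundState : ∃ ω : QLA →ₗ[ℂ] ℂ, IsGroundState ω := by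
  classical
  choose ψ hn hX hZ using exists_unit_stabilized
  let U : Ultrafilter (Finset Face) := Ultrafilter.of atTop
  have hU : (U : Filter (Finset Face)) ≤ atTop := Ultrafilter.of_le atTop
  let e : QLA → Finset Face → ℂ := fun a F => inner ℂ (ψ F) ((a : Conf →L[ℂ] Conf) (ψ F))
  have hb : ∀ a F, ‖e a F‖ ≤ ‖(a : Conf →L[ℂ] Conf)‖ := fun a F => by
    refine (norm_inner_le_norm _ _).trans ?_
    have := (a : Conf →L[ℂ] Conf).le_opNorm (ψ F)
    rw [hn] at this ⊢
    simpa using this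
  have hlim : ∀ a, ∃ z, Tendsto (e a) U (𝓝 z) := fun a => by
    obtain ⟨z, -, hz⟩ := (isCompact_closedBall (0 : ℂ) ‖(a : Conf →L[ℂ] Conf)‖).ultrafilter_le_nhds
      (U.map (e a)) (by
        rw [le_principal_iff]
        exact Filter.mem_map.2 (Filter.univ_mem' fun F => by simpa using hb a F))
    exact ⟨z, hz⟩
  choose w hw using hlim
  have huniq : ∀ a z, Tendsto (e a) U (𝓝 z) → w a = z := fun a z hz =>
    tendsto_nhds_unique (hw a) hz
  refine ⟨{ toFun := w, map_add' := fun a b => ?_, map_smul' := fun c a => ?_ }, ?_⟩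
  · refine huniq _ _ (((hw a).add (hw b)).congr fun F => ?_)
    simp [e]
  · refine huniq _ _ (((hw a).const_mul c).congr fun F => ?_)
    simp [e]
  refine { nonneg := fun a => ?_, map_one := ?_, map_stabK := fun f => ?_, map_stabJ := fun f => ?_ }
  · refine ge_of_tendsto (hw (star a * a)) (Filter.univ_mem' fun F => ?_)
    change (0 : ℂ) ≤ inner ℂ (ψ F)
      ((star (a : Conf →L[ℂ] Conf) * (a : Conf →L[ℂ] Conf)) (ψ F))
    rw [mul_apply_eq_comp, ContinuousLinearMap.star_eq_adjoint,
      ContinuousLinearMap.adjoint_inner_right, inner_self_eq_norm_sq_to_K]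
    exact pow_nonneg (by simp) 2
  · refine huniq _ _ (tendsto_const_nhds.congr fun F => ?_)
    change (1 : ℂ) = inner ℂ (ψ F) (ψ F)
    rw [inner_self_eq_norm_sq_to_K, hn]
    simp
  · refine huniq _ _ (tendsto_const_nhds.congr' ?_)
    filter_upwards [hU (eventually_ge_atTop {f})] with F hF
    change (1 : ℂ) = inner ℂ (ψ F) (pauliX f.boundary (ψ F))
    rw [hX F f (hF (Finset.mem_singleton_self f)), inner_self_eq_norm_sq_to_K, hn]
    simp
  · refine huniq _ _ (tendsto_const_nhds.congr fun F => ?_)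
    change (1 : ℂ) = inner ℂ (ψ F) (pauliZ f.boundary (ψ F))
    rw [hZ F f, inner_self_eq_norm_sq_to_K, hn]
    simp

/-- The ground state `ω₀` of the colour code. -/
def groundState : QLA →ₗ[ℂ] ℂ := Classical.choose exists_isGroundState

theorem groundState_spec : IsGroundState groundState := Classical.choose_spec exists_isGroundState

/-- Representations of the quasi-local algebra on Hilbert spaces. -/
structure Rep where
  space : Type u
  [normed : NormedAddCommGroup space]
  [innerProduct : InnerProductSpace ℂ space]
  [complete : CompleteSpace space]
  hom : QLA →⋆ₐ[ℂ] (space →L[ℂ] space)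

attribute [instance] Rep.normed Rep.innerProduct Rep.complete

namespace Rep

/-- `π` is a GNS representation of the functional `ω`: there is a cyclic vector `Ω` with
`ω(A) = ⟨Ω, π(A) Ω⟩`. -/
def IsGNS (π : Rep.{u}) (ω : QLA →ₗ[ℂ] ℂ) : Prop :=
  ∃ Ω : π.space, (∀ a, ω a = inner ℂ Ω (π.hom a Ω)) ∧ Dense (Set.range fun a => π.hom a Ω)

/-- Unitary equivalence of the restrictions of two representations to `𝒜(Λ)`. -/
def EquivOn (Λ : Set Vertex) (π : Rep.{u}) (π' : Rep.{v}) : Prop :=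
  ∃ U : π.space ≃ₗᵢ[ℂ] π'.space, ∀ a : QLA, (a : Conf →L[ℂ] Conf) ∈ localAlgebra Λ →
    ∀ x, U (π.hom a x) = π'.hom a (U x)

/-- Unitary equivalence of representations. -/
def Equiv (π : Rep.{u}) (π' : Rep.{v}) : Prop :=
  ∃ U : π.space ≃ₗᵢ[ℂ] π'.space, ∀ a x, U (π.hom a x) = π'.hom a (U x)

/-- The representation `π ∘ ρ`. -/
def comp (π : Rep.{u}) (ρ : QLA →⋆ₐ[ℂ] QLA) : Rep.{u} where
  space := π.space
  hom := π.hom.comp ρ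

/-- The superselection criterion relative to `π₀`: for every cone `Λ`, the restriction of `π` to
`𝒜(Λᶜ)` is unitarily equivalent to that of `π₀`. -/
def IsSuperselectionSector (π₀ : Rep.{u}) (π : Rep.{v}) : Prop :=
  ∀ Λ, IsCone Λ → EquivOn Λᶜ π π₀

end Rep

/-! ### Strings and their endomorphisms -/

/-- Half-infinite strings `(f₀, v₀, v₁, f₁, v₂, v₃, f₂, …)` of colour `c`: the faces `f_n` have
colour `c`, and `v_{2n}`, `v_{2n+1}` are the ends of an edge that connects `f_n` to a different
face `f_{n+1}`. No vertex occurs twice. -/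
structure HalfInfiniteString (c : Color) where
  face : ℕ → Face
  vert : ℕ → Vertex
  color_face : ∀ n, (face n).color = c
  face_ne : ∀ n, face n ≠ face (n + 1)
  even_mem : ∀ n, vert (2 * n) ∈ (face n).boundary
  odd_mem : ∀ n, vert (2 * n + 1) ∈ (face (n + 1)).boundary
  adj : ∀ n, lattice.Adj (vert (2 * n)) (vert (2 * n + 1))
  vert_injective : Function.Injective vert

namespace HalfInfiniteString

variable {c : Color}

/-- The support of the string is contained in some cone. -/
def InCone (γ : HalfInfiniteString c) : Prop :=
  ∃ Λ, IsCone Λ ∧ Set.range γ.vert ⊆ Λ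

/-- The support of the finite string `γ_n = (f₀, v₀, v₁, f₁, …, v_{2n-1}, f_n)`. -/
def support (γ : HalfInfiniteString c) (n : ℕ) : Finset Vertex :=
  (Finset.range (2 * n)).image γ.vert

/-- The string operator `S_{γ_n}^{ck}`. -/
def stringOp (γ : HalfInfiniteString c) (k : PauliType) (n : ℕ) : QLA :=
  pauliString k (γ.support n)

theorem mem_support_eventually (γ : HalfInfiniteString c) (v : Vertex) :
    ∃ N, ∀ n, N ≤ n → (v ∈ γ.support n ↔ v ∈ γ.support N) := by
  by_cases h : ∃ m, γ.vert m = v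
  · obtain ⟨m, rfl⟩ := h
    refine ⟨m + 1, fun n hn => ?_⟩
    have : ∀ n, m + 1 ≤ n → γ.vert m ∈ γ.support n := fun n hn =>
      Finset.mem_image_of_mem _ (Finset.mem_range.2 (by omega))
    exact iff_of_true (this n hn) (this _ le_rfl)
  · refine ⟨0, fun n _ => ?_⟩
    have : ∀ n, v ∉ γ.support n := fun n hv => by
      obtain ⟨m, -, hm⟩ := Finset.mem_image.1 hv
      exact h ⟨m, hm⟩
    exact iff_of_false (this n) (this _)

end HalfInfiniteString

theorem pauliString_mem_unitary (k : PauliType) (s : Finset Vertex) :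
    pauliString k s ∈ unitary QLA := by
  have hX : (⟨pauliX s, pauliX_mem s⟩ : QLA) ∈ unitary QLA := by
    rw [Unitary.mem_iff]
    constructor <;>
    · apply Subtype.ext
      change _ * _ = (1 : Conf →L[ℂ] Conf)
      simp [star_pauliX, pauliX_mul, ← pauliX_empty]
  have hZ : (⟨pauliZ s, pauliZ_mem s⟩ : QLA) ∈ unitary QLA := by
    rw [Unitary.mem_iff]
    constructor <;>
    · apply Subtype.ext
      change _ * _ = (1 : Conf →L[ℂ] Conf)
      simp [star_pauliZ, pauliZ_mul, ← pauliZ_empty]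
  cases k
  · exact hX
  · exact mul_mem hX hZ
  · exact hZ

theorem conj_XX (s t : Finset Vertex) : pauliX s * pauliX t * pauliX s = pauliX t := by
  rw [pauliX_mul, pauliX_mul, symmDiff_comm s t, symmDiff_symmDiff_cancel_right]

theorem conj_ZZ (s t : Finset Vertex) : pauliZ s * pauliZ t * pauliZ s = pauliZ t := by
  rw [pauliZ_mul, pauliZ_mul, symmDiff_comm s t, symmDiff_symmDiff_cancel_right]

theorem conj_ZX (s t : Finset Vertex) :
    pauliZ s * pauliX t * pauliZ s = (-1 : ℂ) ^ (s ∩ t).card • pauliX t := by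
  rw [pauliZ_mul_pauliX, smul_mul_assoc, mul_assoc, pauliZ_mul, symmDiff_self,
    Finset.bot_eq_empty, pauliZ_empty, mul_one]

theorem conj_XZ (s t : Finset Vertex) :
    pauliX s * pauliZ t * pauliX s = (-1 : ℂ) ^ (t ∩ s).card • pauliZ t := by
  rw [mul_assoc, pauliZ_mul_pauliX, mul_smul_comm, ← mul_assoc, pauliX_mul, symmDiff_self,
    Finset.bot_eq_empty, pauliX_empty, one_mul]

theorem conj_Y (s : Finset Vertex) (T : Conf →L[ℂ] Conf) :
    star (pauliX s * pauliZ s) * T * (pauliX s * pauliZ s) =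
      pauliZ s * (pauliX s * T * pauliX s) * pauliZ s := by
  rw [star_mul, star_pauliX, star_pauliZ]
  simp only [mul_assoc]

/-- Conjugating a generator at `v` by the Pauli operator on `s` only depends on whether
`v ∈ s`. -/
theorem conj_generator_congr (k : PauliType) {s s' : Finset Vertex} {v : Vertex}
    (h : v ∈ s ↔ v ∈ s') {T : Conf →L[ℂ] Conf} (hT : T = pauliX {v} ∨ T = pauliZ {v}) :
    star (pauliString k s : Conf →L[ℂ] Conf) * T * (pauliString k s : Conf →L[ℂ] Conf) =
      star (pauliString k s' : Conf →L[ℂ] Conf) * T * (pauliString k s' : Conf →L[ℂ] Conf) := by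
  have h1 : s ∩ {v} = s' ∩ {v} := by
    ext x
    simp only [Finset.mem_inter, Finset.mem_singleton]
    constructor
    · rintro ⟨hx, rfl⟩; exact ⟨h.1 hx, rfl⟩
    · rintro ⟨hx, rfl⟩; exact ⟨h.2 hx, rfl⟩
  have h2 : {v} ∩ s = {v} ∩ s' := by rw [Finset.inter_comm, h1, Finset.inter_comm]
  cases k
  · change star (pauliX s) * T * pauliX s = star (pauliX s') * T * pauliX s'
    rw [star_pauliX, star_pauliX]
    rcases hT with rfl | rfl
    · rw [conj_XX, conj_XX]
    · rw [conj_XZ, conj_XZ, h2]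
  · change star (pauliX s * pauliZ s) * T * (pauliX s * pauliZ s) =
      star (pauliX s' * pauliZ s') * T * (pauliX s' * pauliZ s')
    rw [conj_Y, conj_Y]
    rcases hT with rfl | rfl
    · rw [conj_XX, conj_XX, conj_ZX, conj_ZX, h1]
    · rw [conj_XZ, conj_XZ, mul_smul_comm, smul_mul_assoc, conj_ZZ, mul_smul_comm,
        smul_mul_assoc, conj_ZZ, h2]
  · change star (pauliZ s) * T * pauliZ s = star (pauliZ s') * T * pauliZ s'
    rw [star_pauliZ, star_pauliZ]
    rcases hT with rfl | rfl
    · rw [conj_ZX, conj_ZX, h1]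
    · rw [conj_ZZ, conj_ZZ]

/-- For a sequence of unitaries, the operators whose conjugates converge form a closed
⋆-subalgebra. -/
def convergenceAlgebra (u : ℕ → unitary (Conf →L[ℂ] Conf)) :
    StarSubalgebra ℂ (Conf →L[ℂ] Conf) where
  carrier := {T | ∃ L, Tendsto (fun n => star (u n : Conf →L[ℂ] Conf) * T * u n) atTop (𝓝 L)}
  mul_mem' := by
    rintro S T ⟨L, hL⟩ ⟨M, hM⟩
    refine ⟨L * M, (hL.mul hM).congr fun n => ?_⟩
    have h : (u n : Conf →L[ℂ] Conf) * star (u n : Conf →L[ℂ] Conf) = 1 :=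
      Unitary.mul_star_self_of_mem (u n).2
    calc _ = star (u n : Conf →L[ℂ] Conf) * S * ((u n : Conf →L[ℂ] Conf) *
          star (u n : Conf →L[ℂ] Conf)) * T * u n := by simp only [mul_assoc]
      _ = _ := by rw [h, mul_one]; simp only [mul_assoc]
  add_mem' := by
    rintro S T ⟨L, hL⟩ ⟨M, hM⟩
    exact ⟨L + M, (hL.add hM).congr fun n => by rw [mul_add, add_mul]⟩
  algebraMap_mem' r := by
    refine ⟨algebraMap ℂ _ r, tendsto_const_nhds.congr fun n => ?_⟩
    have h : star (u n : Conf →L[ℂ] Conf) * (u n : Conf →L[ℂ] Conf) = 1 :=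
      Unitary.star_mul_self_of_mem (u n).2
    rw [← Algebra.commutes, mul_assoc, h, mul_one]
  star_mem' := by
    rintro T ⟨L, hL⟩
    exact ⟨star L, hL.star.congr fun n => by simp only [star_mul, star_star, mul_assoc]⟩

theorem isClosed_convergenceAlgebra (u : ℕ → unitary (Conf →L[ℂ] Conf)) :
    IsClosed (convergenceAlgebra u : Set (Conf →L[ℂ] Conf)) := by
  have hnorm : ∀ n (T : Conf →L[ℂ] Conf), ‖star (u n : Conf →L[ℂ] Conf) * T * u n‖ = ‖T‖ :=
    fun n T => by
      rw [CStarRing.norm_mul_coe_unitary, ← Unitary.coe_star, CStarRing.norm_coe_unitary_mul]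
  refine isClosed_of_closure_subset fun T hT => ?_
  refine cauchySeq_tendsto_of_complete (Metric.cauchySeq_iff'.2 fun ε hε => ?_)
  obtain ⟨S, ⟨L, hL⟩, hS⟩ := Metric.mem_closure_iff.1 hT (ε / 3) (by positivity)
  obtain ⟨N, hN⟩ := Metric.cauchySeq_iff'.1 hL.cauchySeq (ε / 3) (by positivity)
  have key : ∀ n, dist (star (u n : Conf →L[ℂ] Conf) * T * u n)
      (star (u n : Conf →L[ℂ] Conf) * S * u n) = dist T S := fun n => by
    rw [dist_eq_norm, dist_eq_norm, ← sub_mul, ← mul_sub, hnorm]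
  refine ⟨N, fun n hn => ?_⟩
  have h1 := dist_triangle4 (star (u n : Conf →L[ℂ] Conf) * T * u n)
    (star (u n : Conf →L[ℂ] Conf) * S * u n) (star (u N : Conf →L[ℂ] Conf) * S * u N)
    (star (u N : Conf →L[ℂ] Conf) * T * u N)
  have h2 := hN n hn
  rw [key, dist_comm (star (u N : Conf →L[ℂ] Conf) * S * u N), key] at h1
  linarith

namespace HalfInfiniteString

variable {c : Color}

theorem exists_tendsto (γ : HalfInfiniteString c) (k : PauliType) (a : QLA) :
    ∃ b : QLA, Tendsto (fun n => star (γ.stringOp k n) * a * γ.stringOp k n) atTop (𝓝 b) := by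
  have hmem : ∀ n, (γ.stringOp k n : Conf →L[ℂ] Conf) ∈ unitary (Conf →L[ℂ] Conf) := fun n => by
    have h := Unitary.mem_iff.1 (pauliString_mem_unitary k (γ.support n))
    exact Unitary.mem_iff.2 ⟨congrArg Subtype.val h.1, congrArg Subtype.val h.2⟩
  let u : ℕ → unitary (Conf →L[ℂ] Conf) := fun n => ⟨γ.stringOp k n, hmem n⟩
  have hle : localAlgebra Set.univ ≤ convergenceAlgebra u := by
    refine StarSubalgebra.topologicalClosure_minimal (StarAlgebra.adjoin_le ?_)
      (isClosed_convergenceAlgebra u)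
    rintro T ⟨v, -, hT⟩
    obtain ⟨N, hN⟩ := γ.mem_support_eventually v
    refine ⟨star (u N : Conf →L[ℂ] Conf) * T * u N, tendsto_const_nhds.congr' ?_⟩
    filter_upwards [eventually_ge_atTop N] with n hn
    exact (conj_generator_congr k (hN n hn) hT).symm
  obtain ⟨L, hL⟩ := hle a.2
  refine cauchySeq_tendsto_of_complete ?_
  have h : CauchySeq fun n =>
      ((star (γ.stringOp k n) * a * γ.stringOp k n : QLA) : Conf →L[ℂ] Conf) := hL.cauchySeq
  exact (isometry_subtype_coe.isUniformInducing.cauchy_map_iff).1 (by rw [map_map]; exact h)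

theorem star_mul_stringOp (γ : HalfInfiniteString c) (k : PauliType) (n : ℕ) :
    star (γ.stringOp k n) * γ.stringOp k n = 1 :=
  Unitary.star_mul_self_of_mem (pauliString_mem_unitary k (γ.support n))

/-- `ρ_γ^{ck}(A) = lim_n (S_{γ_n}^{ck})⋆ A S_{γ_n}^{ck}`. -/
def endoFun (γ : HalfInfiniteString c) (k : PauliType) (a : QLA) : QLA :=
  limUnder atTop fun n => star (γ.stringOp k n) * a * γ.stringOp k n

theorem tendsto_endoFun (γ : HalfInfiniteString c) (k : PauliType) (a : QLA) :
    Tendsto (fun n => star (γ.stringOp k n) * a * γ.stringOp k n) atTop (𝓝 (γ.endoFun k a)) :=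
  tendsto_nhds_limUnder (γ.exists_tendsto k a)

theorem endoFun_eq (γ : HalfInfiniteString c) (k : PauliType) {a b : QLA}
    (h : Tendsto (fun n => star (γ.stringOp k n) * a * γ.stringOp k n) atTop (𝓝 b)) :
    γ.endoFun k a = b :=
  tendsto_nhds_unique (γ.tendsto_endoFun k a) h

/-- The endomorphism `ρ_γ^{ck}` of the quasi-local algebra, `A ↦ ρ_γ^{ck}(A)`. -/
def endo (γ : HalfInfiniteString c) (k : PauliType) : QLA →⋆ₐ[ℂ] QLA where
  toFun := γ.endoFun k
  map_one' := γ.endoFun_eq k (tendsto_const_nhds.congr fun n => by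
    rw [mul_one, star_mul_stringOp])
  map_zero' := γ.endoFun_eq k (tendsto_const_nhds.congr fun n => by rw [mul_zero, zero_mul])
  map_mul' a b := γ.endoFun_eq k (((γ.tendsto_endoFun k a).mul (γ.tendsto_endoFun k b)).congr
    fun n => by
      have h : γ.stringOp k n * star (γ.stringOp k n) = 1 :=
        Unitary.mul_star_self_of_mem (pauliString_mem_unitary k (γ.support n))
      calc _ = star (γ.stringOp k n) * a * (γ.stringOp k n * star (γ.stringOp k n)) * b *
            γ.stringOp k n := by simp only [mul_assoc]
        _ = _ := by rw [h, mul_one]; simp only [mul_assoc])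
  map_add' a b := γ.endoFun_eq k (((γ.tendsto_endoFun k a).add (γ.tendsto_endoFun k b)).congr
    fun n => by rw [mul_add, add_mul])
  commutes' r := γ.endoFun_eq k (tendsto_const_nhds.congr fun n => by
    rw [← Algebra.commutes, mul_assoc, star_mul_stringOp, mul_one])
  map_star' a := γ.endoFun_eq k ((γ.tendsto_endoFun k a).star.congr
    fun n => by simp only [star_mul, star_star, mul_assoc])

end HalfInfiniteString

/-- The vertical half-infinite string that starts at the face `f` and goes up. -/
def verticalString {c : Color} (f : Face) (hf : f.color = c) : HalfInfiniteString c where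
  face n := ⟨(f.1.1, f.1.2 + 2 * n), by
    have := f.2
    rw [Int.even_iff] at this ⊢
    dsimp only
    omega⟩
  vert m := (f.1.1 + 1, f.1.2 + 1 + m)
  color_face n := hf
  face_ne n h := by
    have := congrArg (fun g : Face => g.1.2) h
    dsimp only at this
    push_cast at this
    omega
  even_mem n := by
    simp only [Face.boundary, Finset.mem_product, Finset.mem_Icc]
    push_cast
    omega
  odd_mem n := by
    simp only [Face.boundary, Finset.mem_product, Finset.mem_Icc]
    push_cast
    omega
  adj n := by
    have := f.2
    rw [Int.even_iff] at this
    rw [lattice, SimpleGraph.fromRel_adj]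
    refine ⟨fun h => ?_, Or.inl (Or.inr ⟨?_, ?_⟩)⟩
    · have := congrArg Prod.snd h
      dsimp only at this
      push_cast at this
      omega
    · rw [Int.even_iff]
      push_cast
      omega
    · refine Prod.ext rfl ?_
      dsimp only
      push_cast
      ring
  vert_injective m n h := by
    have := congrArg Prod.snd h
    dsimp only at this
    omega

/-- Three mutually adjacent faces, one of each colour. -/
def baseFace : Color → Face
  | .g => ⟨(0, 0), by decide⟩
  | .r => ⟨(1, -1), by decide⟩
  | .b => ⟨(2, 0), by decide⟩

theorem baseFace_color (c : Color) : (baseFace c).color = c := by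
  cases c <;> rfl

/-- The vertical strings `γ_c` of the three colours from three mutually adjacent faces. -/
def baseString (c : Color) : HalfInfiniteString c := 
  verticalString (baseFace c) (baseFace_color c)

/-! ### Sectors and fusion -/

/-- The functional `ω ∘ ρ`. -/
def pullback (ω : QLA →ₗ[ℂ] ℂ) (ρ : QLA →⋆ₐ[ℂ] QLA) : QLA →ₗ[ℂ] ℂ :=
  ω ∘ₗ ρ.toAlgHom.toLinearMap

/-- `π` is a version of `π^{ck}`: a GNS representation of the state `ω₀ ∘ ρ_γ^{ck}` for some
half-infinite string `γ` of colour `c` contained in a cone. -/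
def IsBosonSector (c : Color) (k : PauliType) (π : Rep.{u}) : Prop :=
  ∃ γ : HalfInfiniteString c, γ.InCone ∧ π.IsGNS (pullback groundState (γ.endo k))

/-- The six fermions. -/
inductive Fermion
  | f1 | f2 | f3 | f4 | f5 | f6

/-- The state `ω^{ck,c'k'} = ω₀ ∘ ρ_{γ_c}^{ck} ∘ ρ_{γ_{c'}}^{c'k'}`. -/
def pairState (c : Color) (k : PauliType) (c' : Color) (k' : PauliType) : QLA →ₗ[ℂ] ℂ :=
  pullback groundState (((baseString c).endo k).comp ((baseString c').endo k'))

/-- The states whose GNS representations are the fermionic sectors `π^{f_j}`. -/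
def fermionState : Fermion → QLA →ₗ[ℂ] ℂ
  | .f1 => pairState .r .x .b .z
  | .f2 => pairState .r .z .b .x
  | .f3 => pairState .b .z .g .y
  | .f4 => pairState .r .z .g .y
  | .f5 => pairState .r .x .g .y
  | .f6 => pairState .b .x .g .y

/-- The tensor product of two endomorphisms is their composition, `(ρ ⊗ ρ')(A) = ρ(ρ'(A))`. -/
def tensor (ρ ρ' : QLA →⋆ₐ[ℂ] QLA) : QLA →⋆ₐ[ℂ] QLA := ρ.comp ρ'

/-- `π ≃ π^{ck} ⊗ π^{c'k'}`, where `B` is the family of the sectors `π^{ck}`: for all half-infinite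
strings `γ`, `γ'` of colours `c`, `c'` contained in cones, the endomorphisms `ρ = ρ_γ^{ck}` and
`ρ' = ρ_{γ'}^{c'k'}` represent `π^{ck}` and `π^{c'k'}`, and their tensor product represents `π`. -/
def IsFusion (π₀ : Rep.{u}) (B : Color → PauliType → Rep.{v}) (π : Rep.{w})
    (c : Color) (k : PauliType) (c' : Color) (k' : PauliType) : Prop :=
  ∀ γ : HalfInfiniteString c, γ.InCone → ∀ γ' : HalfInfiniteString c', γ'.InCone →
    (B c k).Equiv (π₀.comp (γ.endo k)) ∧
    (B c' k').Equiv (π₀.comp (γ'.endo k')) ∧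
    π.Equiv (π₀.comp (tensor (γ.endo k) (γ'.endo k')))

end ColorCode

end

open ColorCode

/-!
A Pauli operator is determined, up to a sign, by the chains on which it has `σ^x` and `σ^z` factors.
Conjugation by Pauli operators of infinite support still makes sense and gives the Pauli
endomorphisms; those of the strings are of this kind. The syndrome of a chain is its set of odd
faces. In the plane a finite chain with zero syndrome is a sum of faces, so the star operators
determine the ground state, and a Pauli endomorphism without syndrome preserves it. Since finite
chains only give inner automorphisms, `π₀ ∘ ρ` depends up to equivalence only on the charge of `ρ`,
its syndrome modulo the syndromes of finite chains.

A string has the charge of a single face, and translating a finite chain that moves this face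
along a ray realises the same charge in any cone, where `ρ` is the identity on the complement.
A single vertex lies on one face of each colour, so the charges of the three colours add up to
zero. The fusion rules are then arithmetic in the group of charges.
-/

noncomputable section

namespace ColorCode

open scoped CStarAlgebra

/-! ### Limits of ⋆-homomorphisms -/

section Limits

variable {ι A B : Type*} {l : Filter ι}

theorem isClosed_setOf_cauchy_map [PseudoMetricSpace A] [PseudoMetricSpace B] [l.NeBot]
    {φ : ι → A → B} (hφ : ∀ i a a', dist (φ i a) (φ i a') ≤ dist a a') :
    IsClosed {a | Cauchy (l.map (φ · a))} := by
  refine isClosed_of_closure_subset fun a ha => Metric.cauchy_iff.2 ⟨inferInstance, fun ε hε => ?_⟩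
  obtain ⟨b, hb, hab⟩ := Metric.mem_closure_iff.1 ha (ε / 3) (by positivity)
  obtain ⟨t, ht, htε⟩ := (Metric.cauchy_iff.1 hb).2 (ε / 3) (by positivity)
  refine ⟨_, image_mem_map ht, ?_⟩
  rintro _ ⟨i, hi, rfl⟩ _ ⟨j, hj, rfl⟩
  linarith [dist_triangle4_right (φ i a) (φ j a) (φ i b) (φ j b), hφ i a b, hφ j a b,
    htε _ hi _ hj]

/-- The pointwise limit of a family of ⋆-homomorphisms. -/
def limitStarAlgHom {R : Type*} [CommSemiring R] [Semiring A] [Algebra R A] [Star A]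
    [Semiring B] [Algebra R B] [Star B] [TopologicalSpace B] [T2Space B] [ContinuousAdd B]
    [ContinuousMul B] [ContinuousStar B] [l.NeBot] (φ : ι → A →⋆ₐ[R] B) (f : A → B)
    (h : ∀ a, Tendsto (fun i => φ i a) l (𝓝 (f a))) : A →⋆ₐ[R] B where
  toFun := f
  map_one' := tendsto_nhds_unique (h 1) (by simp)
  map_zero' := tendsto_nhds_unique (h 0) (by simp)
  map_mul' a b := tendsto_nhds_unique (h _) (by simpa only [map_mul] using (h a).mul (h b))
  map_add' a b := tendsto_nhds_unique (h _) (by simpa only [map_add] using (h a).add (h b))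
  commutes' r := tendsto_nhds_unique (h _)
    (by simpa only [AlgHomClass.commutes] using tendsto_const_nhds)
  map_star' a := tendsto_nhds_unique (h _) (by simpa only [map_star] using (h a).star)

end Limits

/-! ### Signs and chains modulo 2 -/

/-- The character `a ↦ (-1)^a` of `ZMod 2`. -/
def sign : AddChar (ZMod 2) ℂ := AddChar.zmodChar 2 neg_one_sq

theorem sign_natCast (n : ℕ) : sign n = (-1) ^ n := AddChar.zmodChar_apply' _ n

theorem sign_one : sign 1 = -1 := by simpa using sign_natCast 1

theorem sign_mul_self (a : ZMod 2) : sign a * sign a = 1 := by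
  rw [← AddChar.map_add_eq_mul, CharTwo.add_self_eq_zero, AddChar.map_zero_eq_one]

/-- The set `s` as a chain with coefficients modulo 2. -/
def chain {α : Type*} (s : Set α) : α → ZMod 2 := s.indicator 1

section Chain

variable {α : Type*}

theorem chain_of_mem {s : Set α} {x : α} (h : x ∈ s) : chain s x = 1 := Set.indicator_of_mem h _

theorem chain_of_notMem {s : Set α} {x : α} (h : x ∉ s) : chain s x = 0 :=
  Set.indicator_of_notMem h _

theorem chain_empty : chain (∅ : Set α) = 0 := Set.indicator_empty _

theorem chain_singleton [DecidableEq α] (x : α) : chain {x} = Pi.single x 1 := by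
  rw [chain, Set.indicator_singleton, Pi.one_apply]

theorem chain_symmDiff (s t : Set α) : chain (s ∆ t) = chain s + chain t := by
  ext x
  by_cases hs : x ∈ s <;> by_cases ht : x ∈ t <;>
    simp [chain, hs, ht, Set.mem_symmDiff, CharTwo.add_self_eq_zero]

theorem sum_chain [DecidableEq α] (s r : Finset α) :
    ∑ x ∈ r, chain (s : Set α) x = ((s ∩ r).card : ZMod 2) := by
  classical
  simp [chain, Set.indicator_apply, Finset.inter_comm]

theorem chain_support (f : α → ZMod 2) : chain (Function.support f) = f := by
  ext x
  by_cases hx : f x = 0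
  · rw [chain_of_notMem (by simpa using hx), hx]
  · exact (chain_of_mem hx).trans (Fin.eq_one_of_ne_zero (f x) hx).symm

/-- The part of the support of a chain inside a finite set. -/
def truncate (f : α → ZMod 2) (s : Finset α) : Finset α := s.filter (f · ≠ 0)

theorem tendsto_chain_truncate (f : α → ZMod 2) :
    Tendsto (fun s => chain (truncate f s : Set α)) atTop (𝓝 f) := by
  refine tendsto_pi_nhds.2 fun x => tendsto_const_nhds.congr' ?_
  filter_upwards [eventually_ge_atTop {x}] with s hs
  have hx : x ∈ s := hs (Finset.mem_singleton_self x)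
  conv_lhs => rw [← chain_support f]
  simp [chain, truncate, Set.indicator, hx]

end Chain

/-! ### Pauli operators -/

/-- The Pauli operator `(⊗_{v ∈ s} σ_v^x) (⊗_{v ∈ t} σ_v^z)`. -/
def pauliOp (s t : Finset Vertex) : QLA := ⟨pauliX s, pauliX_mem s⟩ * ⟨pauliZ t, pauliZ_mem t⟩

theorem coe_pauliOp (s t : Finset Vertex) :
    (pauliOp s t : Conf →L[ℂ] Conf) = pauliX s * pauliZ t := rfl

theorem pauliOp_empty : pauliOp ∅ ∅ = 1 :=
  Subtype.ext (by rw [coe_pauliOp, pauliX_empty, pauliZ_empty, mul_one]; rfl)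

theorem pauliOp_mem_unitary (s t : Finset Vertex) : pauliOp s t ∈ unitary QLA :=
  mul_mem (pauliString_mem_unitary .x s) (pauliString_mem_unitary .z t)

theorem pauliOp_mul (s t s' t' : Finset Vertex) :
    pauliOp s t * pauliOp s' t' =
      sign (∑ v ∈ s', chain (t : Set Vertex) v) • pauliOp (s ∆ s') (t ∆ t') := by
  refine Subtype.ext ?_
  rw [sum_chain, sign_natCast]
  calc pauliX s * pauliZ t * (pauliX s' * pauliZ t')
      = pauliX s * (pauliZ t * pauliX s') * pauliZ t' := by simp only [mul_assoc]
    _ = (-1 : ℂ) ^ (t ∩ s').card • (pauliX s * pauliX s' * (pauliZ t * pauliZ t')) := by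
        rw [pauliZ_mul_pauliX, mul_smul_comm, smul_mul_assoc]
        simp only [mul_assoc]
    _ = _ := by rw [pauliX_mul, pauliZ_mul]; rfl

/-- A possibly infinite Pauli operator up to a phase: its x-part and its z-part. -/
abbrev Pattern : Type := (Vertex → ZMod 2) × (Vertex → ZMod 2)

/-- The commutator exponent of a pattern with the Pauli operator `pauliOp s t`: the number,
modulo 2, of the vertices where the two anticommute. -/
def Pattern.commutator (P : Pattern) (s t : Finset Vertex) : ZMod 2 :=
  ∑ v ∈ s, P.2 v + ∑ v ∈ t, P.1 v

theorem Pattern.commutator_add (P Q : Pattern) (s t : Finset Vertex) :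
    (P + Q).commutator s t = P.commutator s t + Q.commutator s t := by
  simp only [commutator, Prod.fst_add, Prod.snd_add, Pi.add_apply, Finset.sum_add_distrib]
  ring

theorem Pattern.continuous_commutator (s t : Finset Vertex) :
    Continuous fun P : Pattern => P.commutator s t := by
  unfold commutator
  fun_prop

/-- The pattern of `pauliOp s t`. -/
def finsetPattern (s t : Finset Vertex) : Pattern := (chain s, chain t)

theorem pauliOp_mul_comm (s t s' t' : Finset Vertex) :
    pauliOp s t * pauliOp s' t' =
      sign ((finsetPattern s' t').commutator s t) • (pauliOp s' t' * pauliOp s t) := by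
  have hsymm : ∑ v ∈ s', chain (t : Set Vertex) v = ∑ v ∈ t, chain (s' : Set Vertex) v := by
    rw [sum_chain, sum_chain, Finset.inter_comm]
  rw [pauliOp_mul, pauliOp_mul, smul_smul, symmDiff_comm s', symmDiff_comm t',
    Pattern.commutator, AddChar.map_add_eq_mul, mul_right_comm, hsymm]
  simp only [finsetPattern, sign_mul_self, one_mul]

/-- The linear span of the Pauli operators. -/
def pauliSpan : StarSubalgebra ℂ QLA where
  toSubalgebra := (Submodule.span ℂ (Set.range fun p : _ × _ => pauliOp p.1 p.2)).toSubalgebra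
    (Submodule.subset_span ⟨(∅, ∅), pauliOp_empty⟩) fun a b ha hb => by
      have h := Submodule.mul_mem_mul ha hb
      rw [Submodule.span_mul_span] at h
      refine Submodule.span_le.2 ?_ h
      rintro _ ⟨_, ⟨p, rfl⟩, _, ⟨q, rfl⟩, rfl⟩
      change pauliOp _ _ * pauliOp _ _ ∈ Submodule.span ℂ _
      rw [pauliOp_mul]
      exact Submodule.smul_mem _ _ (Submodule.subset_span ⟨(_, _), rfl⟩)
  star_mem' {a} ha := by
    induction ha using Submodule.span_induction with
    | mem x hx =>
      obtain ⟨⟨s, t⟩, rfl⟩ := hx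
      have hstar : star (pauliOp s t) = sign ((s ∩ t).card) • pauliOp s t := by
        refine Subtype.ext ?_
        change star (pauliX s * pauliZ t) = _ • (pauliX s * pauliZ t)
        rw [star_mul, star_pauliX, star_pauliZ, pauliZ_mul_pauliX, sign_natCast, Finset.inter_comm]
      exact hstar ▸ Submodule.smul_mem _ _ (Submodule.subset_span ⟨(s, t), rfl⟩)
    | zero => exact (star_zero QLA).symm ▸ Submodule.zero_mem _
    | add x y _ _ hx hy => exact star_add x y ▸ Submodule.add_mem _ hx hy
    | smul c x _ hx => exact star_smul c x ▸ Submodule.smul_mem _ _ hx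

theorem mem_of_mem_localAlgebra {Λ : Set Vertex} {C : StarSubalgebra ℂ QLA}
    (hC : IsClosed (C : Set QLA)) (hX : ∀ v ∈ Λ, pauliOp {v} ∅ ∈ C)
    (hZ : ∀ v ∈ Λ, pauliOp ∅ {v} ∈ C) {a : QLA} (ha : (a : Conf →L[ℂ] Conf) ∈ localAlgebra Λ) :
    a ∈ C := by
  have hmap : localAlgebra Λ ≤ C.map (localAlgebra Set.univ).subtype := by
    refine StarSubalgebra.topologicalClosure_minimal (StarAlgebra.adjoin_le ?_)
      ((isClosed_localAlgebra Set.univ).isClosedEmbedding_subtypeVal.isClosedMap _ hC)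
    rintro _ ⟨v, hv, rfl | rfl⟩
    · exact ⟨_, hX v hv, by simp [coe_pauliOp, pauliZ_empty]⟩
    · exact ⟨_, hZ v hv, by simp [coe_pauliOp, pauliX_empty]⟩
  obtain ⟨b, hb, hab⟩ := hmap ha
  exact Subtype.ext hab ▸ hb

theorem mem_of_pauliOp_mem {S : Submodule ℂ QLA} (hS : IsClosed (S : Set QLA))
    (h : ∀ s t, pauliOp s t ∈ S) (a : QLA) : a ∈ S := by
  have hle : (pauliSpan : Set QLA) ⊆ S :=
    Submodule.span_le.2 (Set.range_subset_iff.2 fun p => h p.1 p.2)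
  have hmem : ∀ s t, pauliOp s t ∈ pauliSpan.topologicalClosure := fun s t =>
    subset_closure (Submodule.subset_span ⟨(s, t), rfl⟩)
  exact closure_minimal hle hS (mem_of_mem_localAlgebra
    (StarSubalgebra.isClosed_topologicalClosure _) (fun v _ => hmem _ _) (fun v _ => hmem _ _) a.2)

theorem linearMap_ext_pauliOp {V : Type*} [TopologicalSpace V] [T2Space V] [AddCommMonoid V]
    [Module ℂ V] {f g : QLA →ₗ[ℂ] V} (hf : Continuous f) (hg : Continuous g)
    (h : ∀ s t, f (pauliOp s t) = g (pauliOp s t)) : f = g :=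
  LinearMap.ext (mem_of_pauliOp_mem (S := LinearMap.eqLocus f g) (isClosed_eq hf hg) h)

theorem starAlgHom_ext_pauliOp {ρ ρ' : QLA →⋆ₐ[ℂ] QLA}
    (h : ∀ s t, ρ (pauliOp s t) = ρ' (pauliOp s t)) : ρ = ρ' :=
  StarAlgHom.ext <| LinearMap.congr_fun <| linearMap_ext_pauliOp
    (f := ρ.toAlgHom.toLinearMap) (g := ρ'.toAlgHom.toLinearMap)
    (map_continuous ρ) (map_continuous ρ') h

/-! ### Pauli endomorphisms -/

/-- The inner automorphism `a ↦ u⋆ a u` given by a unitary element `u`. -/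
def conjBy (u : unitary QLA) : QLA →⋆ₐ[ℂ] QLA := Unitary.conjStarAlgAut ℂ QLA (star u)

theorem conjBy_apply (u : unitary QLA) (a : QLA) : conjBy u a = star (u : QLA) * a * u :=
  Unitary.conjStarAlgAut_star_apply (S := ℂ) u a

/-- Conjugation by the finite Pauli operator `pauliOp s t`. -/
def pauliConj (s t : Finset Vertex) : QLA →⋆ₐ[ℂ] QLA := conjBy ⟨_, pauliOp_mem_unitary s t⟩

theorem pauliConj_pauliOp (s t s' t' : Finset Vertex) :
    pauliConj s t (pauliOp s' t') =
      sign ((finsetPattern s t).commutator s' t') • pauliOp s' t' := by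
  rw [pauliConj, conjBy_apply, mul_assoc, pauliOp_mul_comm, mul_smul_comm, ← mul_assoc,
    Unitary.star_mul_self_of_mem (pauliOp_mem_unitary s t), one_mul]

section Approximation

variable {ι : Type*} {l : Filter ι} {s t : ι → Finset Vertex} {P : Pattern}

theorem tendsto_pauliConj_pauliOp (h : Tendsto (fun i => finsetPattern (s i) (t i)) l (𝓝 P))
    (s' t' : Finset Vertex) : Tendsto (fun i => pauliConj (s i) (t i) (pauliOp s' t')) l
      (𝓝 (sign (P.commutator s' t') • pauliOp s' t')) := by
  simp only [pauliConj_pauliOp]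
  have hsign : Continuous sign := continuous_of_discreteTopology
  exact Tendsto.smul_const (((hsign.comp (Pattern.continuous_commutator s' t')).tendsto P).comp h) _

theorem exists_tendsto_pauliConj [l.NeBot]
    (h : Tendsto (fun i => finsetPattern (s i) (t i)) l (𝓝 P)) (a : QLA) :
    ∃ b, Tendsto (fun i => pauliConj (s i) (t i) a) l (𝓝 b) := by
  let φ : ι → QLA →⋆ₐ[ℂ] QLA := fun i => pauliConj (s i) (t i)
  have hφ : ∀ i a b, dist (φ i a) (φ i b) ≤ dist a b := fun i a b => by
    rw [dist_eq_norm, dist_eq_norm, ← map_sub]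
    exact NonUnitalStarAlgHom.norm_apply_le (φ i) _
  let S : Submodule ℂ QLA :=
    { carrier := {a | Cauchy (l.map (φ · a))}
      zero_mem' := by simpa using tendsto_const_nhds.cauchy_map
      add_mem' := fun {a b} ha hb => by
        obtain ⟨c, hc⟩ := CompleteSpace.complete ha
        obtain ⟨d, hd⟩ := CompleteSpace.complete hb
        simpa only [Set.mem_ofPred_eq, map_add] using (Tendsto.add hc hd).cauchy_map
      smul_mem' := fun z a ha => by
        obtain ⟨c, hc⟩ := CompleteSpace.complete ha
        simpa only [Set.mem_ofPred_eq, map_smul] using (Tendsto.const_smul hc z).cauchy_map }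
  exact CompleteSpace.complete (mem_of_pauliOp_mem (S := S) (isClosed_setOf_cauchy_map hφ)
    (fun s' t' => (tendsto_pauliConj_pauliOp h s' t').cauchy_map) a)

end Approximation

theorem exists_starAlgHom_pauliOp (P : Pattern) : ∃ ρ : QLA →⋆ₐ[ℂ] QLA,
    ∀ s t, ρ (pauliOp s t) = sign (P.commutator s t) • pauliOp s t := by
  have hP : Tendsto (fun F => finsetPattern (truncate P.1 F) (truncate P.2 F)) atTop (𝓝 P) :=
    (tendsto_chain_truncate P.1).prodMk_nhds (tendsto_chain_truncate P.2)
  choose f hf using exists_tendsto_pauliConj hP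
  exact ⟨limitStarAlgHom _ f hf, fun s t =>
    tendsto_nhds_unique (hf _) (tendsto_pauliConj_pauliOp hP s t)⟩

/-- The endomorphism of the quasi-local algebra that acts as the conjugation by a possibly
infinite Pauli operator. -/
def pauliEndo (P : Pattern) : QLA →⋆ₐ[ℂ] QLA := (exists_starAlgHom_pauliOp P).choose

theorem pauliEndo_pauliOp (P : Pattern) (s t : Finset Vertex) :
    pauliEndo P (pauliOp s t) = sign (P.commutator s t) • pauliOp s t :=
  (exists_starAlgHom_pauliOp P).choose_spec s t

theorem eq_pauliEndo_of_tendsto {ι : Type*} {l : Filter ι} [l.NeBot] {s t : ι → Finset Vertex}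
    {P : Pattern} (hP : Tendsto (fun i => finsetPattern (s i) (t i)) l (𝓝 P))
    {ρ : QLA →⋆ₐ[ℂ] QLA} (hρ : ∀ a, Tendsto (fun i => pauliConj (s i) (t i) a) l (𝓝 (ρ a))) :
    ρ = pauliEndo P :=
  starAlgHom_ext_pauliOp fun s' t' =>
    tendsto_nhds_unique (hρ _) (pauliEndo_pauliOp P s' t' ▸ tendsto_pauliConj_pauliOp hP s' t')

theorem pauliEndo_finsetPattern (s t : Finset Vertex) :
    pauliEndo (finsetPattern s t) = pauliConj s t :=
  starAlgHom_ext_pauliOp fun s' t' => by rw [pauliEndo_pauliOp, pauliConj_pauliOp]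

theorem pauliEndo_add (P Q : Pattern) :
    pauliEndo (P + Q) = (pauliEndo P).comp (pauliEndo Q) :=
  starAlgHom_ext_pauliOp fun s t => by
    rw [StarAlgHom.comp_apply, pauliEndo_pauliOp, pauliEndo_pauliOp, map_smul, pauliEndo_pauliOp,
      smul_smul, Pattern.commutator_add, AddChar.map_add_eq_mul, mul_comm]

theorem pauliEndo_surjective (P : Pattern) : Function.Surjective (pauliEndo P) := fun a => by
  refine ⟨pauliEndo P a, ?_⟩
  have h : pauliEndo 0 = StarAlgHom.id ℂ QLA := starAlgHom_ext_pauliOp fun s t => by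
    simp [pauliEndo_pauliOp, Pattern.commutator]
  rw [← StarAlgHom.comp_apply, ← pauliEndo_add, ZModModule.add_self, h]
  rfl

theorem pauliEndo_apply_eq_self {P : Pattern} {M : Set Vertex} (hX : Set.EqOn P.1 0 M)
    (hZ : Set.EqOn P.2 0 M) {a : QLA} (ha : (a : Conf →L[ℂ] Conf) ∈ localAlgebra M) :
    pauliEndo P a = a := by
  refine mem_of_mem_localAlgebra
    (C := StarAlgHom.equalizer (pauliEndo P) (StarAlgHom.id ℂ QLA)) (Λ := M)
    (isClosed_eq (map_continuous (pauliEndo P)) continuous_id) (fun v hv => ?_) (fun v hv => ?_) ha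
  · simp [pauliEndo_pauliOp, Pattern.commutator, hZ hv]
  · simp [pauliEndo_pauliOp, Pattern.commutator, hX hv]

namespace PauliType

/-- The exponent of `σ^x` in a Pauli matrix. -/
def xPart : PauliType → ZMod 2
  | x | y => 1
  | z => 0

/-- The exponent of `σ^z` in a Pauli matrix. -/
def zPart : PauliType → ZMod 2
  | x => 0
  | y | z => 1

/-- The pattern with the Pauli matrix `k` on the support of a chain. -/
def pattern (k : PauliType) (S : Vertex → ZMod 2) : Pattern := (k.xPart • S, k.zPart • S)

theorem continuous_pattern (k : PauliType) : Continuous k.pattern := by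
  unfold pattern
  fun_prop

end PauliType

theorem exists_pauliString_eq_pauliOp (k : PauliType) (s : Finset Vertex) :
    ∃ a b, pauliString k s = pauliOp a b ∧ finsetPattern a b = k.pattern (chain s) := by
  have hX : (⟨pauliX ∅, pauliX_mem ∅⟩ : QLA) = 1 := Subtype.ext pauliX_empty
  have hZ : (⟨pauliZ ∅, pauliZ_mem ∅⟩ : QLA) = 1 := Subtype.ext pauliZ_empty
  cases k with
  | x => exact ⟨s, ∅, by simp [pauliOp, pauliString, hZ], by
      simp [finsetPattern, PauliType.pattern, PauliType.xPart, PauliType.zPart, chain_empty]⟩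
  | y => exact ⟨s, s, rfl, by
      simp [finsetPattern, PauliType.pattern, PauliType.xPart, PauliType.zPart]⟩
  | z => exact ⟨∅, s, by simp [pauliOp, pauliString, hX], by
      simp [finsetPattern, PauliType.pattern, PauliType.xPart, PauliType.zPart, chain_empty]⟩

namespace HalfInfiniteString

variable {c : Color} (γ : HalfInfiniteString c)

theorem tendsto_chain_support :
    Tendsto (fun n => chain (γ.support n : Set Vertex)) atTop (𝓝 (chain (Set.range γ.vert))) := by
  refine tendsto_pi_nhds.2 fun v => tendsto_const_nhds.congr' ?_
  by_cases hv : v ∈ Set.range γ.vert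
  · obtain ⟨m, rfl⟩ := hv
    filter_upwards [eventually_gt_atTop m] with n hn
    rw [chain_of_mem (Set.mem_range_self m), chain_of_mem]
    exact Finset.mem_image_of_mem _ (Finset.mem_range.2 (by omega))
  · refine Eventually.of_forall fun n => ?_
    have hn : v ∉ γ.support n := fun h => hv (by
      obtain ⟨m, -, rfl⟩ := Finset.mem_image.1 h
      exact Set.mem_range_self m)
    exact (chain_of_notMem hv).trans (chain_of_notMem hn).symm

theorem endo_eq_pauliEndo (k : PauliType) :
    γ.endo k = pauliEndo (k.pattern (chain (Set.range γ.vert))) := by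
  choose a b hab hpat using fun n => exists_pauliString_eq_pauliOp k (γ.support n)
  refine eq_pauliEndo_of_tendsto (l := atTop) (s := a) (t := b) ?_ fun A => ?_
  · simp only [hpat]
    exact (k.continuous_pattern.tendsto _).comp γ.tendsto_chain_support
  · refine (γ.tendsto_endoFun k A).congr fun n => ?_
    simp only [pauliConj, conjBy_apply, ← hab]
    rfl

end HalfInfiniteString

/-! ### Syndromes and exactness -/

/-- The finitely supported chains. -/
def finiteChains (α : Type*) : Submodule (ZMod 2) (α → ZMod 2) where
  carrier := {f | f.support.Finite}
  zero_mem' := by simp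
  add_mem' hf hg := (hf.union hg).subset (Function.support_add _ _)
  smul_mem' c _ hf := hf.subset (Function.support_const_smul_subset c _)

theorem mem_finiteChains_iff {α : Type*} {f : α → ZMod 2} :
    f ∈ finiteChains α ↔ ∃ s : Finset α, chain (s : Set α) = f := by
  constructor
  · intro hf
    have hfin : f.support.Finite := hf
    exact ⟨hfin.toFinset, by rw [Set.Finite.coe_toFinset, chain_support]⟩
  · rintro ⟨s, rfl⟩
    exact s.finite_toSet.subset Set.support_indicator_subset

theorem chain_singleton_mem_finiteChains {α : Type*} (x : α) : chain {x} ∈ finiteChains α :=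
  mem_finiteChains_iff.2 ⟨{x}, by rw [Finset.coe_singleton]⟩

/-- The syndrome of a chain: its parity on the boundary of every face. The stabilizers violated by
a Pauli operator are the supports of the syndromes of its x-part and its z-part. -/
def syndrome : (Vertex → ZMod 2) →ₗ[ZMod 2] (Face → ZMod 2) :=
  LinearMap.pi fun f => ∑ v ∈ f.boundary, LinearMap.proj v

theorem syndrome_apply (S : Vertex → ZMod 2) (f : Face) :
    syndrome S f = ∑ v ∈ f.boundary, S v := by
  simp [syndrome]

theorem continuous_syndrome : Continuous syndrome := by
  refine continuous_pi fun f => ?_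
  simp only [syndrome_apply]
  fun_prop

theorem Face.mem_boundary {v : Vertex} {f : Face} : v ∈ f.boundary ↔
    (f.1.1 ≤ v.1 ∧ v.1 ≤ f.1.1 + 2) ∧ (f.1.2 ≤ v.2 ∧ v.2 ≤ f.1.2 + 1) := by
  simp only [Face.boundary, Finset.mem_product, Finset.mem_Icc]

/-- The face with lower left corner `(i, j)`. -/
def mkFace (i j : ℤ) (h : Even (i + j)) : Face := ⟨(i, j), h⟩

theorem mem_boundary_mkFace {x y i j : ℤ} {h : Even (i + j)} : (x, y) ∈ (mkFace i j h).boundary ↔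
    (i ≤ x ∧ x ≤ i + 2) ∧ (j ≤ y ∧ y ≤ j + 1) :=
  Face.mem_boundary

theorem syndrome_mkFace (S : Vertex → ZMod 2) {i j : ℤ} (h : Even (i + j)) :
    syndrome S (mkFace i j h) = S (i, j) + S (i + 1, j) + S (i + 2, j) +
      (S (i, j + 1) + S (i + 1, j + 1) + S (i + 2, j + 1)) := by
  have h3 : Finset.Icc i (i + 2) = {i, i + 1, i + 2} := by
    ext x; simp only [Finset.mem_Icc, Finset.mem_insert, Finset.mem_singleton]; omega
  have h2 : Finset.Icc j (j + 1) = {j, j + 1} := by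
    ext x; simp only [Finset.mem_Icc, Finset.mem_insert, Finset.mem_singleton]; omega
  rw [syndrome_apply, Face.boundary, mkFace, Finset.sum_product_right]
  dsimp only
  rw [h2, Finset.sum_pair (by omega), h3]
  congr 1 <;>
  · rw [Finset.sum_insert (by simp), Finset.sum_pair (by omega), add_assoc]

theorem syndrome_chain_boundary (f : Face) : syndrome (chain f.boundary) = 0 := by
  ext g
  rw [syndrome_apply, sum_chain]
  exact ZMod.natCast_eq_zero_iff_even.2 (even_inter f g)

/-- The chains generated by the boundaries of the faces. -/
def faceSpan : Submodule (ZMod 2) (Vertex → ZMod 2) :=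
  Submodule.span _ (Set.range fun f : Face => chain f.boundary)

theorem faceSpan_le_ker_syndrome : faceSpan ≤ LinearMap.ker syndrome :=
  Submodule.span_le.2 (Set.range_subset_iff.2 syndrome_chain_boundary)

theorem faceSpan_le_finiteChains : faceSpan ≤ finiteChains Vertex :=
  Submodule.span_le.2 (Set.range_subset_iff.2 fun f => mem_finiteChains_iff.2 ⟨f.boundary, rfl⟩)

theorem eq_zero_of_forall_sum_three_eq_zero {M : Type*} [AddCommGroup M] {a : ℤ → M}
    (ha : a.support.Finite) (h : ∀ x, a x + a (x + 1) + a (x + 2) = 0) : a = 0 := by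
  have hper : Function.Periodic a 3 := fun x => by
    have h' := h (x + 1)
    rw [add_assoc x, add_assoc x, one_add_one_eq_two, show (1 + 2 : ℤ) = 3 by rfl] at h'
    have hx := h x
    rw [add_assoc] at hx
    exact (eq_neg_of_add_eq_zero_right h').trans (eq_neg_of_add_eq_zero_left hx).symm
  by_contra hne
  obtain ⟨x, hx⟩ := Function.ne_iff.1 hne
  refine Set.infinite_of_injective_forall_mem (f := fun n : ℤ => x + n * 3) (fun m n hmn => ?_)
    (fun n => ?_) ha
  · dsimp only at hmn
    omega
  · have hn : a (x + n * 3) = a x := hper.int_mul n x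
    rwa [Function.mem_support, hn]

theorem eq_zero_of_syndrome_eq_zero_of_row {S : Vertex → ZMod 2} (hS : S ∈ finiteChains Vertex)
    (hsyn : syndrome S = 0) {j : ℤ} (hrow : ∀ x y, y ≠ j → S (x, y) = 0) : S = 0 := by
  have h3 : ∀ x, S (x, j) + S (x + 1, j) + S (x + 2, j) = 0 := fun x => by
    rcases Int.even_or_odd (x + j) with h | h
    · have h' := congrFun hsyn (mkFace x j h)
      simpa [syndrome_mkFace, hrow _ (j + 1)] using h'
    · have h' := congrFun hsyn (mkFace x (j - 1) (by rw [← add_sub_assoc]; exact h.sub_odd odd_one))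
      simpa [syndrome_mkFace, hrow _ (j - 1)] using h'
  have hfin : (Function.support fun x => S (x, j)).Finite :=
    Set.Finite.preimage (Prod.mk_left_injective j).injOn hS
  have hj := eq_zero_of_forall_sum_three_eq_zero hfin h3
  ext ⟨x, y⟩
  rcases eq_or_ne y j with rfl | hy
  · exact congrFun hj x
  · exact hrow x y hy

theorem eq_zero_of_syndrome_eq_zero_of_even {S : Vertex → ZMod 2} (hsyn : syndrome S = 0) {j : ℤ}
    (habove : ∀ x, S (x, j + 1) = 0) (heven : ∀ x, Even (x + j) → S (x, j) = 0) (x : ℤ) :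
    S (x, j) = 0 := by
  rcases Int.even_or_odd (x + j) with h | h
  · exact heven x h
  · have hl : Even (x - 1 + j) := by rw [Int.odd_iff] at h; rw [Int.even_iff]; omega
    have hr : Even (x - 1 + 2 + j) := by rw [Int.odd_iff] at h; rw [Int.even_iff]; omega
    simpa [syndrome_mkFace, heven _ hl, heven _ hr, habove]
      using congrFun hsyn (mkFace (x - 1) j hl)

/-- The face below a vertex `(x, j)` with `x + j` even meets the row `j` in no other vertex with
this parity. -/
theorem exists_mem_faceSpan_eq_of_even (j : ℤ) (E : Finset ℤ) : ∃ T ∈ faceSpan,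
    (∀ x y, y ≠ j → y ≠ j - 1 → T (x, y) = 0) ∧
      ∀ x, Even (x + j) → T (x, j) = chain (E : Set ℤ) x := by
  induction E using Finset.induction_on with
  | empty => exact ⟨0, zero_mem _, by simp, by simp [chain_empty]⟩
  | insert a E ha ih =>
    obtain ⟨T, hT, hrows, heven⟩ := ih
    by_cases hpar : Even (a + j)
    · have hf : Even (a - 1 + (j - 1)) := by rw [Int.even_iff] at hpar ⊢; omega
      refine ⟨T + chain (mkFace (a - 1) (j - 1) hf).boundary,
        add_mem hT (Submodule.subset_span ⟨_, rfl⟩),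
        fun x y hy hy' => ?_, fun x hx => ?_⟩
      · have hnot : (x, y) ∉ (mkFace (a - 1) (j - 1) hf).boundary := by
          rw [mem_boundary_mkFace]
          omega
        rw [Pi.add_apply, hrows x y hy hy', chain_of_notMem hnot, add_zero]
      · have hmem : (x, j) ∈ (mkFace (a - 1) (j - 1) hf).boundary ↔ x = a := by
          rw [Int.even_iff] at hx hpar
          rw [mem_boundary_mkFace]
          omega
        rw [Pi.add_apply, heven x hx]
        rcases eq_or_ne x a with rfl | hxa
        · simp [chain, Set.indicator, hmem.2 rfl, ha]
        · simp [chain, Set.indicator, hmem, hxa]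
    · refine ⟨T, hT, hrows, fun x hx => ?_⟩
      have hxa : x ≠ a := by rintro rfl; exact hpar hx
      simp [heven x hx, chain, Set.indicator, hxa]

theorem mem_faceSpan_of_rows (n : ℕ) {S : Vertex → ZMod 2} (hS : S ∈ finiteChains Vertex)
    (hsyn : syndrome S = 0) {m : ℤ} (hrows : ∀ x y, y < m ∨ m + n < y → S (x, y) = 0) :
    S ∈ faceSpan := by
  induction n generalizing S with
  | zero =>
    rw [eq_zero_of_syndrome_eq_zero_of_row hS hsyn (j := m) fun x y hy =>
      hrows x y (by push_cast; omega)]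
    exact zero_mem _
  | succ n ih =>
    obtain ⟨E, hE⟩ := mem_finiteChains_iff.1 (Set.Finite.preimage
      (Prod.mk_left_injective (m + (n + 1))).injOn hS : (fun x => S (x, m + (n + 1))) ∈ _)
    obtain ⟨T, hT, hTrows, hTeven⟩ := exists_mem_faceSpan_eq_of_even (m + (n + 1)) E
    have hsyn' : syndrome (S - T) = 0 := by
      rw [map_sub, hsyn, LinearMap.mem_ker.1 (faceSpan_le_ker_syndrome hT), sub_zero]
    have habove : ∀ x y, y < m ∨ m + (n + 1) < y → (S - T) (x, y) = 0 := fun x y hy => by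
      rw [Pi.sub_apply, hrows x y (by push_cast; exact hy), hTrows x y (by omega) (by omega),
        sub_zero]
    have htop : ∀ x, (S - T) (x, m + (n + 1)) = 0 :=
      eq_zero_of_syndrome_eq_zero_of_even hsyn' (fun x => habove x _ (by omega)) fun x hx => by
        rw [Pi.sub_apply, hTeven x hx, hE, sub_self]
    have hsub : S - T ∈ faceSpan :=
      ih (sub_mem hS (faceSpan_le_finiteChains hT)) hsyn' fun x y hy => by
        rcases eq_or_ne y (m + (n + 1)) with rfl | hne
        · exact htop x
        · exact habove x y (by omega)
    exact sub_add_cancel S T ▸ add_mem hsub hT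

theorem mem_faceSpan_of_syndrome_eq_zero {S : Vertex → ZMod 2} (hS : S ∈ finiteChains Vertex)
    (hsyn : syndrome S = 0) : S ∈ faceSpan := by
  obtain ⟨M, hM⟩ := (Set.Finite.image Prod.snd hS).bddAbove
  obtain ⟨m, hm⟩ := (Set.Finite.image Prod.snd hS).bddBelow
  refine mem_faceSpan_of_rows (M - m).toNat hS hsyn (m := m) fun x y hy => ?_
  by_contra hne
  have hle : y ≤ M := hM ⟨(x, y), hne, rfl⟩
  have hge : m ≤ y := hm ⟨(x, y), hne, rfl⟩
  omega

/-! ### Edges and strings -/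

theorem Face.color_eq_iff {f g : Face} : f.color = g.color ↔ f.1.1 % 3 = g.1.1 % 3 := by
  have hf : f.1.1 % 3 = 0 ∨ f.1.1 % 3 = 1 ∨ f.1.1 % 3 = 2 := by omega
  have hg : g.1.1 % 3 = 0 ∨ g.1.1 % 3 = 1 ∨ g.1.1 % 3 = 2 := by omega
  rcases hf with h | h | h <;> rcases hg with h' | h' | h' <;> simp [Face.color, h, h']

theorem Face.eq_of_color_eq_of_mem_boundary {f g : Face} {v : Vertex} (hc : f.color = g.color)
    (hf : v ∈ f.boundary) (hg : v ∈ g.boundary) : f = g := by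
  rw [Face.color_eq_iff] at hc
  rw [Face.mem_boundary] at hf hg
  have hfe := Int.even_iff.1 f.2
  have hge := Int.even_iff.1 g.2
  exact Subtype.ext (Prod.ext (by omega) (by omega))

theorem Face.eq_of_adj_of_mem_boundary {f g : Face} {u v : Vertex} (h : lattice.Adj u v)
    (hfu : u ∈ f.boundary) (hfv : v ∉ f.boundary) (hgu : u ∈ g.boundary) (hgv : v ∉ g.boundary) :
    f = g := by
  rw [Face.mem_boundary] at hfu hfv hgu hgv
  have hfe := Int.even_iff.1 f.2
  have hge := Int.even_iff.1 g.2
  obtain ⟨u1, u2⟩ := u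
  obtain ⟨v1, v2⟩ := v
  rw [lattice, SimpleGraph.fromRel_adj] at h
  simp only [Prod.mk.injEq, Int.even_iff] at h hfu hfv hgu hgv
  exact Subtype.ext (Prod.ext (by omega) (by omega))

theorem syndrome_chain_singleton (v : Vertex) :
    syndrome (chain {v}) = chain {f : Face | v ∈ f.boundary} := by
  ext f
  rw [syndrome_apply, chain_singleton, Finset.sum_pi_single']
  simp only [chain, Set.indicator_apply, Set.mem_ofPred_eq, Pi.one_apply]

theorem syndrome_edge {f g : Face} {u v : Vertex} (hc : f.color = g.color) (hne : f ≠ g)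
    (h : lattice.Adj u v) (hu : u ∈ f.boundary) (hv : v ∈ g.boundary) :
    syndrome (chain {u} + chain {v}) = chain {f} + chain {g} := by
  have hfv : v ∉ f.boundary := fun h' => hne (Face.eq_of_color_eq_of_mem_boundary hc h' hv)
  have hgu : u ∉ g.boundary := fun h' => hne (Face.eq_of_color_eq_of_mem_boundary hc hu h')
  rw [map_add, syndrome_chain_singleton, syndrome_chain_singleton, ← chain_symmDiff,
    ← chain_symmDiff]
  congr 1
  ext e
  simp only [Set.mem_symmDiff, Set.mem_ofPred_eq, Set.mem_singleton_iff]
  constructor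
  · rintro (⟨heu, hev⟩ | ⟨hev, heu⟩)
    · obtain rfl := Face.eq_of_adj_of_mem_boundary h heu hev hu hfv
      exact Or.inl ⟨rfl, hne⟩
    · obtain rfl := Face.eq_of_adj_of_mem_boundary h.symm hev heu hv hgu
      exact Or.inr ⟨rfl, hne.symm⟩
  · rintro (⟨rfl, -⟩ | ⟨rfl, -⟩)
    · exact Or.inl ⟨hu, hfv⟩
    · exact Or.inr ⟨hv, hgu⟩

theorem sum_range_add_succ {M : Type*} [AddCommGroup M] [Module (ZMod 2) M] (a : ℕ → M) (n : ℕ) :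
    ∑ k ∈ Finset.range n, (a k + a (k + 1)) = a 0 + a n := by
  simpa only [ZModModule.sub_eq_add, add_comm] using Finset.sum_range_sub a n

/-- The far end of a telescoping sum of syndromes escapes to infinity. -/
theorem syndrome_eq_of_tendsto_sum {Q : ℕ → Vertex → ZMod 2} {S : Vertex → ZMod 2} {F : ℕ → Face}
    (hQ : Tendsto (fun n => ∑ k ∈ Finset.range n, Q k) atTop (𝓝 S))
    (hsyn : ∀ k, syndrome (Q k) = chain {F k} + chain {F (k + 1)}) (hF : Tendsto F atTop cofinite) :
    syndrome S = chain {F 0} := by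
  have hend : Tendsto (fun n => chain {F n}) atTop (𝓝 0) := by
    refine tendsto_pi_nhds.2 fun e => tendsto_const_nhds.congr' ?_
    filter_upwards [hF.eventually (Set.finite_singleton e).compl_mem_cofinite] with n hn
    exact (chain_of_notMem (Ne.symm hn)).symm
  refine tendsto_nhds_unique ((continuous_syndrome.tendsto S).comp hQ) ?_
  simpa [Function.comp_def, hsyn, sum_range_add_succ fun n => chain {F n}]
    using hend.const_add (chain {F 0})

theorem chain_coe_eq_sum {α : Type*} (s : Finset α) : chain (s : Set α) = ∑ x ∈ s, chain {x} := by
  classical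
  ext x
  simp [Finset.sum_pi_single, chain, Set.indicator_apply]

namespace HalfInfiniteString

variable {c : Color} (γ : HalfInfiniteString c)

theorem chain_support_eq_sum (n : ℕ) : chain (γ.support n : Set Vertex) =
    ∑ k ∈ Finset.range n, (chain {γ.vert (2 * k)} + chain {γ.vert (2 * k + 1)}) := by
  rw [chain_coe_eq_sum, support, Finset.sum_image γ.vert_injective.injOn]
  induction n with
  | zero => rfl
  | succ n ih => rw [Nat.mul_succ, Finset.sum_range_succ, Finset.sum_range_succ, ih,
      Finset.sum_range_succ, add_assoc]

theorem tendsto_face : Tendsto γ.face atTop cofinite := by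
  have hinj : Function.Injective fun n => γ.vert (2 * n) := fun m n h => by
    have := γ.vert_injective h
    omega
  rw [← Nat.cofinite_eq_atTop]
  refine Tendsto.cofinite_of_finite_preimage_singleton fun e => ?_
  exact (Set.Finite.preimage hinj.injOn e.boundary.finite_toSet).subset fun n hn =>
    Set.mem_singleton_iff.1 hn ▸ γ.even_mem n

theorem syndrome_chain_range : syndrome (chain (Set.range γ.vert)) = chain {γ.face 0} :=
  syndrome_eq_of_tendsto_sum (γ.tendsto_chain_support.congr γ.chain_support_eq_sum)
    (fun n => syndrome_edge ((γ.color_face n).trans (γ.color_face (n + 1)).symm) (γ.face_ne n)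
      (γ.adj n) (γ.even_mem n) (γ.odd_mem n)) γ.tendsto_face

end HalfInfiniteString

/-! ### Charges -/

/-- The charges: the syndromes of Pauli operators of arbitrary support, modulo the syndromes of
the operators of finite support. -/
abbrev ChargeGroup : Type := (Face → ZMod 2) ⧸ (finiteChains Vertex).map syndrome

/-- The charge of the Pauli operator with one Pauli matrix along a chain. -/
def charge : (Vertex → ZMod 2) →ₗ[ZMod 2] ChargeGroup :=
  ((finiteChains Vertex).map syndrome).mkQ ∘ₗ syndrome

/-- The charge of a single excited face. -/
def faceCharge (f : Face) : ChargeGroup := Submodule.Quotient.mk (chain {f})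

theorem charge_eq_zero_of_mem {S : Vertex → ZMod 2} (hS : S ∈ finiteChains Vertex) :
    charge S = 0 :=
  (Submodule.Quotient.mk_eq_zero _).2 (Submodule.mem_map_of_mem hS)

theorem exists_syndrome_eq_zero_of_charge_eq {S S' : Vertex → ZMod 2} (h : charge S = charge S') :
    ∃ s : Finset Vertex, syndrome (S + S' + chain s) = 0 := by
  obtain ⟨T, hT, hsyn⟩ := (Submodule.Quotient.eq _).1 h
  obtain ⟨s, rfl⟩ := mem_finiteChains_iff.1 hT
  exact ⟨s, by rw [map_add, hsyn, ← map_sub, ZModModule.sub_eq_add, ZModModule.add_self]⟩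

/-- The translations of the lattice that preserve the colours of the faces. -/
def colorLattice : AddSubgroup (ℤ × ℤ) where
  carrier := {τ | Even (τ.1 + τ.2) ∧ 3 ∣ τ.1}
  zero_mem' := by simp
  add_mem' {σ τ} hσ hτ := ⟨by simpa [add_add_add_comm] using hσ.1.add hτ.1, dvd_add hσ.2 hτ.2⟩
  neg_mem' {τ} hτ := ⟨by simpa [neg_add_rev, add_comm] using hτ.1.neg, (dvd_neg (α := ℤ)).2 hτ.2⟩

instance : AddAction colorLattice Face where
  vadd τ f := ⟨(τ : ℤ × ℤ) + f.1, by simpa [add_add_add_comm] using τ.2.1.add f.2⟩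
  zero_vadd f := Subtype.ext (zero_add f.1)
  add_vadd σ τ f := Subtype.ext (add_assoc (σ : ℤ × ℤ) τ f.1)

namespace Face

theorem coe_vadd (τ : colorLattice) (f : Face) : (τ +ᵥ f).1 = (τ : ℤ × ℤ) + f.1 := rfl

theorem vadd_mem_boundary_vadd {τ : colorLattice} {v : Vertex} {f : Face} :
    τ +ᵥ v ∈ (τ +ᵥ f).boundary ↔ v ∈ f.boundary := by
  simp only [mem_boundary, coe_vadd, AddSubgroup.vadd_def, vadd_eq_add, Prod.fst_add, Prod.snd_add]
  omega

theorem color_vadd (τ : colorLattice) (f : Face) : (τ +ᵥ f).color = f.color := by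
  rw [color_eq_iff, coe_vadd, Prod.fst_add]
  have := τ.2.2
  omega

theorem vadd_left_injective (f : Face) : Function.Injective fun τ : colorLattice => τ +ᵥ f :=
  fun _ _ h => Subtype.ext (add_right_cancel (congrArg Subtype.val h))

theorem exists_vadd_eq_of_color_eq {f g : Face} (hc : f.color = g.color) :
    ∃ τ : colorLattice, τ +ᵥ f = g := by
  rw [color_eq_iff] at hc
  refine ⟨⟨g.1 - f.1, ?_, ?_⟩, Subtype.ext (sub_add_cancel g.1 f.1)⟩
  · simpa [sub_add_sub_comm] using g.2.sub f.2
  · rw [Prod.fst_sub]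
    omega

end Face

/-- The translation to the nearest face of the same colour on the upper right. -/
def diagonalStep : colorLattice := ⟨(3, 1), by decide, by decide⟩

/-- The translation to the nearest face of the same colour above. -/
def verticalStep : colorLattice := ⟨(0, 2), by decide, by decide⟩

theorem closure_steps_eq_top : AddSubgroup.closure {diagonalStep, verticalStep} = ⊤ := by
  refine (AddSubgroup.eq_top_iff' _).2 fun τ => ?_
  obtain ⟨heven, k, hk⟩ := τ.2
  obtain ⟨l, hl⟩ : Even ((τ : ℤ × ℤ).2 - k) := by rw [Int.even_iff] at heven ⊢; omega
  have h : τ = k • diagonalStep + l • verticalStep := by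
    refine Subtype.ext (Prod.ext ?_ ?_) <;> simp [diagonalStep, verticalStep] <;> omega
  rw [h]
  exact add_mem (zsmul_mem (AddSubgroup.subset_closure (by simp)) _)
    (zsmul_mem (AddSubgroup.subset_closure (by simp)) _)

theorem faceCharge_eq_of_adj {f g : Face} {u v : Vertex} (hc : f.color = g.color) (hne : f ≠ g)
    (h : lattice.Adj u v) (hu : u ∈ f.boundary) (hv : v ∈ g.boundary) :
    faceCharge f = faceCharge g := by
  refine (Submodule.Quotient.eq _).2
    ⟨_, add_mem (chain_singleton_mem_finiteChains u) (chain_singleton_mem_finiteChains v), ?_⟩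
  rw [syndrome_edge hc hne h hu hv, ZModModule.sub_eq_add]

theorem lattice_adj_right (x y : ℤ) : lattice.Adj (x, y) (x + 1, y) := by
  rw [lattice, SimpleGraph.fromRel_adj]
  simp

theorem lattice_adj_up {x y : ℤ} (h : Even (x + y)) : lattice.Adj (x, y) (x, y + 1) := by
  rw [lattice, SimpleGraph.fromRel_adj]
  simp [h]

theorem faceCharge_eq_of_vadd_eq {τ : colorLattice} (hτ : τ ≠ 0) {f : Face} {u v : Vertex}
    (h : lattice.Adj u v) (hu : u ∈ f.boundary) (hv : v ∈ (τ +ᵥ f).boundary) :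
    faceCharge (τ +ᵥ f) = faceCharge f :=
  (faceCharge_eq_of_adj (f.color_vadd τ).symm
    (fun hf => hτ (f.vadd_left_injective (hf.symm.trans (zero_vadd _ f).symm))) h hu hv).symm

theorem faceCharge_vadd (τ : colorLattice) (f : Face) : faceCharge (τ +ᵥ f) = faceCharge f := by
  have hτ : τ ∈ AddSubgroup.closure _ := closure_steps_eq_top.symm ▸ AddSubgroup.mem_top τ
  induction hτ using AddSubgroup.closure_induction generalizing f with
  | zero => rw [zero_vadd]
  | add σ τ _ _ hσ hτ => rw [add_vadd, hσ, hτ]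
  | neg τ _ hτ => rw [← hτ, vadd_neg_vadd]
  | mem τ hτ =>
    rcases hτ with rfl | rfl
    · refine faceCharge_eq_of_vadd_eq (by decide) (lattice_adj_right (f.1.1 + 2) (f.1.2 + 1)) ?_ ?_
        <;> simp only [Face.mem_boundary, Face.coe_vadd, Prod.fst_add, Prod.snd_add, diagonalStep]
        <;> omega
    · have hf := Int.even_iff.1 f.2
      refine faceCharge_eq_of_vadd_eq (by decide) (lattice_adj_up (x := f.1.1 + 1) (y := f.1.2 + 1)
        (Int.even_iff.2 (by omega))) ?_ ?_
        <;> simp only [Face.mem_boundary, Face.coe_vadd, Prod.fst_add, Prod.snd_add, verticalStep]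
        <;> omega

theorem faceCharge_eq_of_color_eq {f g : Face} (hc : f.color = g.color) :
    faceCharge f = faceCharge g := by
  obtain ⟨τ, rfl⟩ := Face.exists_vadd_eq_of_color_eq hc
  exact (faceCharge_vadd τ f).symm

/-- The charge of an excited face of colour `c`. -/
def colorCharge (c : Color) : ChargeGroup := faceCharge (baseFace c)

theorem faceCharge_eq_colorCharge (f : Face) : faceCharge f = colorCharge f.color :=
  faceCharge_eq_of_color_eq (baseFace_color f.color).symm

theorem HalfInfiniteString.charge_chain_range {c : Color} (γ : HalfInfiniteString c) :
    charge (chain (Set.range γ.vert)) = colorCharge c := by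
  rw [charge, LinearMap.comp_apply, γ.syndrome_chain_range]
  exact (faceCharge_eq_colorCharge _).trans (congrArg colorCharge (γ.color_face 0))

theorem sum_colorCharge_eq_zero : colorCharge .r + colorCharge .g + colorCharge .b = 0 := by
  have hdisj : ∀ e : Face, ((2, 0) : Vertex) ∈ e.boundary ↔
      (e = baseFace .r ∨ e = baseFace .g ∨ e = baseFace .b) := fun e => by
    have heq : ∀ c, e = baseFace c ↔ e.1.1 = (baseFace c).1.1 ∧ e.1.2 = (baseFace c).1.2 :=
      fun c => Subtype.ext_iff.trans Prod.ext_iff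
    have he := Int.even_iff.1 e.2
    rw [heq, heq, heq, Face.mem_boundary]
    simp only [baseFace]
    omega
  have hinj : Function.Injective baseFace := Function.LeftInverse.injective baseFace_color
  have hset : {f : Face | (2, 0) ∈ f.boundary} =
      ({baseFace .r} ∆ {baseFace .g}) ∆ {baseFace .b} := by
    ext e
    have hrg := hinj.ne (show Color.r ≠ .g from nofun)
    have hrb := hinj.ne (show Color.r ≠ .b from nofun)
    have hgb := hinj.ne (show Color.g ≠ .b from nofun)
    simp only [hdisj, Set.mem_symmDiff, Set.mem_singleton_iff, Set.mem_ofPred_eq]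
    grind
  have h : charge (chain {((2, 0) : Vertex)}) = 0 :=
    charge_eq_zero_of_mem (chain_singleton_mem_finiteChains _)
  rw [charge, LinearMap.comp_apply, syndrome_chain_singleton, hset, chain_symmDiff,
    chain_symmDiff] at h
  exact h

/-! ### Uniqueness of the ground state -/

section PositiveFunctional

variable {A : Type*} [CStarAlgebra A] {φ : A →ₗ[ℂ] ℂ} {u : A}

theorem exists_positiveLinearMap_eq (hφ : ∀ a, 0 ≤ φ (star a * a)) :
    letI := CStarAlgebra.spectralOrder A
    ∃ ψ : A →ₚ[ℂ] ℂ, ∀ a, φ a = ψ a := by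
  let _ := CStarAlgebra.spectralOrder A
  have _ := CStarAlgebra.spectralOrderedRing A
  refine ⟨.mk₀ φ fun a ha => ?_, fun a => rfl⟩
  obtain ⟨b, rfl⟩ := CStarAlgebra.nonneg_iff_eq_star_mul_self.1 ha
  exact hφ b

theorem continuous_of_nonneg_star_mul_self (hφ : ∀ a, 0 ≤ φ (star a * a)) : Continuous φ := by
  let _ := CStarAlgebra.spectralOrder A
  have _ := CStarAlgebra.spectralOrderedRing A
  obtain ⟨ψ, hψ⟩ := exists_positiveLinearMap_eq hφ
  exact (map_continuous ψ).congr fun a => (hψ a).symm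

theorem map_star_of_nonneg_star_mul_self (hφ : ∀ a, 0 ≤ φ (star a * a)) (a : A) :
    φ (star a) = star (φ a) := by
  let _ := CStarAlgebra.spectralOrder A
  have _ := CStarAlgebra.spectralOrderedRing A
  obtain ⟨ψ, hψ⟩ := exists_positiveLinearMap_eq hφ
  rw [hψ, hψ, map_star]

theorem map_mul_eq_zero_of_map_star_mul_self_eq_zero (hφ : ∀ a, 0 ≤ φ (star a * a)) {b : A}
    (hb : φ (star b * b) = 0) (a : A) : φ (a * b) = 0 := by
  let _ := CStarAlgebra.spectralOrder A
  have _ := CStarAlgebra.spectralOrderedRing A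
  obtain ⟨ψ, hψ⟩ := exists_positiveLinearMap_eq hφ
  rw [hψ] at hb ⊢
  have hnorm : ‖ψ.toPreGNS b‖ = 0 := by
    rw [← sq_eq_zero_iff, ← Complex.ofReal_eq_zero, Complex.ofReal_pow, ψ.preGNS_norm_sq,
      ψ.ofPreGNS_toPreGNS, hb]
  have hinner : inner ℂ (ψ.toPreGNS (star a)) (ψ.toPreGNS b) = 0 :=
    norm_le_zero_iff.1 ((norm_inner_le_norm _ _).trans_eq (by rw [hnorm, mul_zero]))
  rwa [ψ.preGNS_inner_def, ψ.ofPreGNS_toPreGNS, ψ.ofPreGNS_toPreGNS, star_star] at hinner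

theorem map_mul_unitary_of_map_eq_one (hφ : ∀ a, 0 ≤ φ (star a * a)) (hφ1 : φ 1 = 1)
    (hu : u ∈ unitary A) (h : φ u = 1) (a : A) : φ (a * u) = φ a := by
  have hb : φ (star (u - 1) * (u - 1)) = 0 := by
    rw [star_sub, star_one, sub_mul, mul_sub, one_mul, mul_one, Unitary.star_mul_self_of_mem hu]
    simp only [map_sub, map_star_of_nonneg_star_mul_self hφ, hφ1, h, star_one, sub_self]
  rw [← sub_eq_zero, ← map_sub, ← mul_sub_one,
    map_mul_eq_zero_of_map_star_mul_self_eq_zero hφ hb]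

theorem map_unitary_mul_of_map_eq_one (hφ : ∀ a, 0 ≤ φ (star a * a)) (hφ1 : φ 1 = 1)
    (hu : u ∈ unitary A) (h : φ u = 1) (a : A) : φ (u * a) = φ a := by
  have hstar : φ (star u) = 1 := by rw [map_star_of_nonneg_star_mul_self hφ, h, star_one]
  rw [← star_star (u * a), map_star_of_nonneg_star_mul_self hφ, star_mul,
    map_mul_unitary_of_map_eq_one hφ hφ1 (Unitary.star_mem hu) hstar,
    map_star_of_nonneg_star_mul_self hφ, star_star]

theorem map_eq_zero_of_unitary_mul_eq_smul (hφ : ∀ a, 0 ≤ φ (star a * a)) (hφ1 : φ 1 = 1)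
    (hu : u ∈ unitary A) (h : φ u = 1) {a : A} {z : ℂ} (hz : z ≠ 1)
    (hua : u * a = z • (a * u)) : φ a = 0 := by
  have heq : φ a = z * φ a := calc
    φ a = φ (u * a) := (map_unitary_mul_of_map_eq_one hφ hφ1 hu h a).symm
    _ = z * φ (a * u) := by rw [hua, map_smul, smul_eq_mul]
    _ = z * φ a := by rw [map_mul_unitary_of_map_eq_one hφ hφ1 hu h]
  by_contra hne
  exact hz ((right_eq_mul₀ hne).1 heq)

end PositiveFunctional

theorem chain_coe_injective {α : Type*} :
    Function.Injective fun s : Finset α => chain (s : Set α) := fun _ _ h =>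
  Finset.coe_injective (Set.indicator_one_inj _ h)

theorem closed_finset_induction {p : Finset Vertex → Prop} (empty : p ∅)
    (boundary : ∀ f : Face, p f.boundary) (symmDiff : ∀ s t, p s → p t → p (s ∆ t))
    {s : Finset Vertex} (hs : syndrome (chain s) = 0) : p s := by
  have key : ∀ S ∈ faceSpan, ∃ t : Finset Vertex, chain (t : Set Vertex) = S ∧ p t := by
    intro S hS
    induction hS using Submodule.span_induction with
    | mem S hS =>
      obtain ⟨f, rfl⟩ := hS
      exact ⟨f.boundary, rfl, boundary f⟩
    | zero => exact ⟨∅, by rw [Finset.coe_empty, chain_empty], empty⟩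
    | add S T _ _ hS hT =>
      obtain ⟨s, rfl, hs⟩ := hS
      obtain ⟨t, rfl, ht⟩ := hT
      exact ⟨s ∆ t, by rw [Finset.coe_symmDiff, chain_symmDiff], symmDiff s t hs ht⟩
    | smul a S _ hS =>
      obtain rfl | ha := eq_or_ne a 0
      · exact ⟨∅, by rw [Finset.coe_empty, chain_empty, zero_smul], empty⟩
      · have ha' : a = 1 := Fin.eq_one_of_ne_zero a ha
        rwa [ha', one_smul]
  obtain ⟨t, ht, h⟩ := key _ (mem_faceSpan_of_syndrome_eq_zero (mem_finiteChains_iff.2 ⟨s, rfl⟩) hs)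
  rwa [← chain_coe_injective ht]

theorem pauliOp_empty_mul (s s' t : Finset Vertex) :
    pauliOp s ∅ * pauliOp s' t = pauliOp (s ∆ s') t := by
  rw [pauliOp_mul, sum_chain, Finset.empty_inter, Finset.card_empty, Nat.cast_zero,
    AddChar.map_zero_eq_one, one_smul, ← Finset.bot_eq_empty, bot_symmDiff]

theorem pauliOp_mul_pauliOp_empty (s t t' : Finset Vertex) :
    pauliOp s t * pauliOp ∅ t' = pauliOp s (t ∆ t') := by
  rw [pauliOp_mul, Finset.sum_empty, AddChar.map_zero_eq_one, one_smul, ← Finset.bot_eq_empty,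
    symmDiff_bot]

theorem stabK_eq_pauliOp (f : Face) : stabK f = pauliOp f.boundary ∅ :=
  Subtype.ext (by rw [coe_pauliOp, pauliZ_empty, mul_one]; rfl)

theorem stabJ_eq_pauliOp (f : Face) : stabJ f = pauliOp ∅ f.boundary :=
  Subtype.ext (by rw [coe_pauliOp, pauliX_empty, one_mul]; rfl)

theorem sign_eq_one_iff {a : ZMod 2} : sign a = 1 ↔ a = 0 := by
  refine ⟨fun h => ?_, fun h => h ▸ sign.map_zero_eq_one⟩
  by_contra ha
  rw [Fin.eq_one_of_ne_zero a ha] at h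
  exact absurd (sign_one.symm.trans h) (by norm_num)

namespace IsGroundState

variable {ω : QLA →ₗ[ℂ] ℂ}

theorem map_mul_pauliOp (hω : IsGroundState ω) {s t : Finset Vertex} (h : ω (pauliOp s t) = 1)
    (a : QLA) : ω (a * pauliOp s t) = ω a :=
  map_mul_unitary_of_map_eq_one hω.nonneg hω.map_one (pauliOp_mem_unitary s t) h a

theorem map_pauliOp_eq_one (hω : IsGroundState ω) {s t : Finset Vertex}
    (hs : syndrome (chain s) = 0) (ht : syndrome (chain t) = 0) : ω (pauliOp s t) = 1 := by
  have hempty : ω (pauliOp ∅ ∅) = 1 := by rw [pauliOp_empty, hω.map_one]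
  have hX : ω (pauliOp s ∅) = 1 :=
    closed_finset_induction (p := fun s => ω (pauliOp s ∅) = 1) hempty
      (fun f => by rw [← stabK_eq_pauliOp, hω.map_stabK])
      (fun _ _ h h' => by rw [← pauliOp_empty_mul, hω.map_mul_pauliOp h', h]) hs
  have hZ : ω (pauliOp ∅ t) = 1 :=
    closed_finset_induction (p := fun t => ω (pauliOp ∅ t) = 1) hempty
      (fun f => by rw [← stabJ_eq_pauliOp, hω.map_stabJ])
      (fun _ _ h h' => by rw [← pauliOp_mul_pauliOp_empty, hω.map_mul_pauliOp h', h]) ht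
  rw [← symmDiff_bot s, Finset.bot_eq_empty, ← pauliOp_empty_mul, hω.map_mul_pauliOp hZ, hX]

theorem map_pauliOp_eq_zero (hω : IsGroundState ω) {s t : Finset Vertex}
    (h : syndrome (chain s) ≠ 0 ∨ syndrome (chain t) ≠ 0) : ω (pauliOp s t) = 0 := by
  have key : ∀ a b : Finset Vertex, ω (pauliOp a b) = 1 → (finsetPattern s t).commutator a b ≠ 0 →
      ω (pauliOp s t) = 0 := fun a b hab hne =>
    map_eq_zero_of_unitary_mul_eq_smul hω.nonneg hω.map_one (pauliOp_mem_unitary a b) hab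
      (sign_eq_one_iff.not.2 hne) (pauliOp_mul_comm a b s t)
  rcases h with h | h <;> obtain ⟨f, hf⟩ := Function.ne_iff.1 h <;> rw [syndrome_apply] at hf
  · refine key ∅ f.boundary (by rw [← stabJ_eq_pauliOp, hω.map_stabJ]) ?_
    rwa [Pattern.commutator, Finset.sum_empty, zero_add]
  · refine key f.boundary ∅ (by rw [← stabK_eq_pauliOp, hω.map_stabK]) ?_
    rwa [Pattern.commutator, Finset.sum_empty, add_zero]

theorem eq {ω' : QLA →ₗ[ℂ] ℂ} (hω : IsGroundState ω) (hω' : IsGroundState ω') : ω = ω' := by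
  refine linearMap_ext_pauliOp (continuous_of_nonneg_star_mul_self hω.nonneg)
    (continuous_of_nonneg_star_mul_self hω'.nonneg) fun s t => ?_
  by_cases h : syndrome (chain s) ≠ 0 ∨ syndrome (chain t) ≠ 0
  · rw [hω.map_pauliOp_eq_zero h, hω'.map_pauliOp_eq_zero h]
  · push Not at h
    rw [hω.map_pauliOp_eq_one h.1 h.2, hω'.map_pauliOp_eq_one h.1 h.2]

theorem pullback_pauliEndo (hω : IsGroundState ω) {P : Pattern} (hX : syndrome P.1 = 0)
    (hZ : syndrome P.2 = 0) : IsGroundState (pullback ω (pauliEndo P)) where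
  nonneg a := by
    have h := hω.nonneg (pauliEndo P a)
    rwa [← map_star, ← map_mul] at h
  map_one := (congrArg ω (_root_.map_one (pauliEndo P))).trans hω.map_one
  map_stabK f := by
    have h : P.commutator f.boundary ∅ = 0 := by
      rw [Pattern.commutator, Finset.sum_empty, add_zero, ← syndrome_apply, hZ, Pi.zero_apply]
    change ω (pauliEndo P (stabK f)) = 1
    rw [stabK_eq_pauliOp, pauliEndo_pauliOp, h, AddChar.map_zero_eq_one, one_smul,
      ← stabK_eq_pauliOp, hω.map_stabK]
  map_stabJ f := by
    have h : P.commutator ∅ f.boundary = 0 := by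
      rw [Pattern.commutator, Finset.sum_empty, zero_add, ← syndrome_apply, hX, Pi.zero_apply]
    change ω (pauliEndo P (stabJ f)) = 1
    rw [stabJ_eq_pauliOp, pauliEndo_pauliOp, h, AddChar.map_zero_eq_one, one_smul,
      ← stabJ_eq_pauliOp, hω.map_stabJ]

end IsGroundState

/-! ### Representations -/

namespace Rep

theorem Equiv.symm {π : Rep.{u}} {π' : Rep.{v}} (h : π.Equiv π') : π'.Equiv π := by
  obtain ⟨U, hU⟩ := h
  exact ⟨U.symm, fun a x => by
    rw [LinearIsometryEquiv.symm_apply_eq, hU, LinearIsometryEquiv.apply_symm_apply]⟩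

theorem Equiv.trans {π : Rep.{u}} {π' : Rep.{v}} {π'' : Rep.{w}} (h : π.Equiv π')
    (h' : π'.Equiv π'') : π.Equiv π'' := by
  obtain ⟨U, hU⟩ := h
  obtain ⟨V, hV⟩ := h'
  exact ⟨U.trans V, fun a x => by simp only [LinearIsometryEquiv.trans_apply, hU, hV]⟩

theorem Equiv.comp {π : Rep.{u}} {π' : Rep.{v}} (h : π.Equiv π') (ρ : QLA →⋆ₐ[ℂ] QLA) :
    (π.comp ρ).Equiv (π'.comp ρ) := by
  obtain ⟨U, hU⟩ := h
  exact ⟨U, fun a x => hU (ρ a) x⟩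

theorem comp_comp (π : Rep.{u}) (ρ ρ' : QLA →⋆ₐ[ℂ] QLA) :
    (π.comp ρ).comp ρ' = π.comp (ρ.comp ρ') := rfl

theorem hom_mul_apply (π : Rep.{u}) (a b : QLA) (x : π.space) :
    π.hom (a * b) x = π.hom a (π.hom b x) := by
  rw [map_mul, mul_apply_eq_comp]

theorem inner_hom_apply_self (π : Rep.{u}) (a : QLA) (x : π.space) :
    inner ℂ (π.hom a x) (π.hom a x) = inner ℂ x (π.hom (star a * a) x) := by
  rw [hom_mul_apply, map_star, ContinuousLinearMap.star_eq_adjoint,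
    ContinuousLinearMap.adjoint_inner_right]

theorem IsGNS.equiv {π : Rep.{u}} {π' : Rep.{v}} {ω : QLA →ₗ[ℂ] ℂ} (h : π.IsGNS ω)
    (h' : π'.IsGNS ω) : π.Equiv π' := by
  obtain ⟨Ω, hω, hd⟩ := h
  obtain ⟨Ω', hω', hd'⟩ := h'
  let e := (ContinuousLinearMap.apply ℂ π.space Ω).toLinearMap ∘ₗ π.hom.toAlgHom.toLinearMap
  let e' := (ContinuousLinearMap.apply ℂ π'.space Ω').toLinearMap ∘ₗ π'.hom.toAlgHom.toLinearMap
  have hnorm : ∀ a, ‖π'.hom a Ω'‖ = ‖π.hom a Ω‖ := fun a => by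
    rw [@norm_eq_sqrt_re_inner ℂ, @norm_eq_sqrt_re_inner ℂ, inner_hom_apply_self,
      inner_hom_apply_self, ← hω, ← hω']
  let U := (LinearEquiv.refl ℂ QLA).extendOfIsometry e e' hd hd' hnorm
  have hU : ∀ a, U (π.hom a Ω) = π'.hom a Ω' :=
    (LinearEquiv.refl ℂ QLA).extendOfIsometry_eq e e' hd hd' hnorm
  refine ⟨U, fun a => congrFun (DenseRange.equalizer (f := fun b => π.hom b Ω) hd
    (g := fun x => U (π.hom a x)) (h := fun x => π'.hom a (U x)) (by fun_prop) (by fun_prop)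
    (funext fun b => ?_))⟩
  rw [Function.comp_apply, Function.comp_apply, ← hom_mul_apply, hU, hU, ← hom_mul_apply]

theorem IsGNS.comp {π : Rep.{u}} {ω : QLA →ₗ[ℂ] ℂ} (h : π.IsGNS ω) {ρ : QLA →⋆ₐ[ℂ] QLA}
    (hρ : Function.Surjective ρ) : (π.comp ρ).IsGNS (pullback ω ρ) := by
  obtain ⟨Ω, hω, hd⟩ := h
  exact ⟨Ω, fun a => hω (ρ a), DenseRange.comp hd hρ.denseRange (by fun_prop)⟩

theorem comp_conjBy_equiv (π : Rep.{u}) (u : unitary QLA) : (π.comp (conjBy u)).Equiv π := by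
  refine ⟨Unitary.linearIsometryEquiv ⟨π.hom u, Unitary.map_mem π.hom u.2⟩, fun a x => ?_⟩
  have h : (u : QLA) * conjBy u a = a * u := by
    rw [conjBy_apply, ← mul_assoc, ← mul_assoc, Unitary.mul_star_self_of_mem u.2, one_mul]
  exact (π.hom_mul_apply u (conjBy u a) x).symm.trans (h ▸ π.hom_mul_apply a u x)

theorem IsGNS.equiv_comp_pauliEndo {π₀ : Rep.{u}} (h₀ : π₀.IsGNS groundState) {π : Rep.{v}}
    {P : Pattern} (h : π.IsGNS (pullback groundState (pauliEndo P))) :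
    π.Equiv (π₀.comp (pauliEndo P)) :=
  h.equiv (h₀.comp (pauliEndo_surjective P))

theorem IsGNS.comp_pauliEndo_equiv_self {π₀ : Rep.{u}} (h₀ : π₀.IsGNS groundState)
    {P : Pattern} (hX : syndrome P.1 = 0) (hZ : syndrome P.2 = 0) :
    (π₀.comp (pauliEndo P)).Equiv π₀ := by
  have h := h₀.comp (pauliEndo_surjective P)
  rw [(groundState_spec.pullback_pauliEndo hX hZ).eq groundState_spec] at h
  exact h.equiv h₀

theorem IsGNS.comp_pauliEndo_equiv {π₀ : Rep.{u}} (h₀ : π₀.IsGNS groundState) {P Q : Pattern}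
    (hX : charge P.1 = charge Q.1) (hZ : charge P.2 = charge Q.2) :
    (π₀.comp (pauliEndo P)).Equiv (π₀.comp (pauliEndo Q)) := by
  obtain ⟨s, hs⟩ := exists_syndrome_eq_zero_of_charge_eq hX
  obtain ⟨t, ht⟩ := exists_syndrome_eq_zero_of_charge_eq hZ
  have hsum : (P + Q + finsetPattern s t) + Q = finsetPattern s t + P := by
    rw [add_right_comm P, add_assoc, ZModModule.add_self, add_zero, add_comm]
  have hinner : (π₀.comp (pauliEndo (finsetPattern s t + P))).Equiv (π₀.comp (pauliEndo P)) := by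
    rw [pauliEndo_add, ← comp_comp, pauliEndo_finsetPattern, pauliConj]
    exact (π₀.comp_conjBy_equiv _).comp (pauliEndo P)
  refine hinner.symm.trans ?_
  rw [← hsum, pauliEndo_add, ← comp_comp]
  exact (h₀.comp_pauliEndo_equiv_self (P := P + Q + finsetPattern s t) hs ht).comp (pauliEndo Q)

end Rep

/-! ### Transporting charges into cones -/

/-- The translate of a chain by a lattice vector. Sums of translates along a ray carry charges into
cones. -/
def translate {α : Type*} [AddAction colorLattice α] (τ : colorLattice) (P : α → ZMod 2) :
    α → ZMod 2 :=
  fun x => P (-τ +ᵥ x)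

theorem translate_chain_singleton {α : Type*} [AddAction colorLattice α] (τ : colorLattice)
    (x : α) : translate τ (chain {x}) = chain {τ +ᵥ x} := by
  classical
  ext y
  simp only [translate, chain, Set.indicator_apply, Set.mem_singleton_iff, neg_vadd_eq_iff,
    Pi.one_apply]

theorem syndrome_translate (τ : colorLattice) (P : Vertex → ZMod 2) :
    syndrome (translate τ P) = translate τ (syndrome P) := by
  ext f
  simp only [translate, syndrome_apply]
  exact Finset.sum_equiv (AddAction.toPerm (-τ)) (fun v => Face.vadd_mem_boundary_vadd.symm)
    fun v _ => rfl

theorem summable_translate {P : Vertex → ZMod 2} (hP : P ∈ finiteChains Vertex)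
    {σ : ℕ → colorLattice} (hσ : Function.Injective σ) :
    Summable fun n => translate (σ n) P := by
  refine Pi.summable.2 fun v => summable_of_hasFiniteSupport ?_
  exact Set.Finite.preimage (f := fun n => -σ n +ᵥ v)
    (fun m _ n _ h => hσ (neg_injective (Subtype.ext (add_right_cancel h)))) hP

theorem exists_mem_finiteChains_syndrome_eq (τ : colorLattice) (f : Face) :
    ∃ P ∈ finiteChains Vertex, syndrome P = chain {f} + chain {τ +ᵥ f} := by
  obtain ⟨P, hP, h⟩ := (Submodule.Quotient.eq _).1 (faceCharge_vadd τ f).symm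
  exact ⟨P, hP, h.trans (ZModModule.sub_eq_add _ _)⟩

theorem exists_syndrome_eq_of_eventually_vadd_mem {Λ : Set Vertex} {τ : colorLattice} (hτ : τ ≠ 0)
    (hΛ : ∀ v : Vertex, ∀ᶠ n : ℕ in atTop, n • τ +ᵥ v ∈ Λ) (f : Face) :
    ∃ (S : Vertex → ZMod 2) (σ : colorLattice),
      Set.EqOn S 0 Λᶜ ∧ syndrome S = chain {σ +ᵥ f} := by
  obtain ⟨P, hP, hsyn⟩ := exists_mem_finiteChains_syndrome_eq τ f
  obtain ⟨N, hN⟩ : ∃ N : ℕ, ∀ n ≥ N, ∀ v ∈ P.support, n • τ +ᵥ v ∈ Λ :=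
    eventually_atTop.1 ((eventually_all_finite hP).2 fun v _ => hΛ v)
  let σ : ℕ → colorLattice := fun n => (N + n) • τ
  have hσ : Function.Injective σ := (injective_nsmul_iff_not_isOfFinAddOrder.2
    (not_isOfFinAddOrder_of_isAddTorsionFree hτ)).comp (add_right_injective N)
  have hsum := summable_translate hP hσ
  refine ⟨∑' n, translate (σ n) P, σ 0, fun v hv => ?_, ?_⟩
  · have hzero (n : ℕ) : translate (σ n) P v = 0 := by
      by_contra hn
      exact hv (by simpa only [σ, vadd_neg_vadd] using hN (N + n) (Nat.le_add_right N n) _ hn)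
    rw [tsum_apply hsum]
    simp only [hzero, tsum_zero, Pi.zero_apply]
  · refine syndrome_eq_of_tendsto_sum hsum.hasSum.tendsto_sum_nat (F := fun n => σ n +ᵥ f)
      (fun n => ?_) ?_
    · have hstep : σ (n + 1) = σ n + τ := succ_nsmul τ (N + n)
      rw [syndrome_translate, hsyn, hstep, add_vadd, ← translate_chain_singleton (σ n),
        ← translate_chain_singleton (σ n)]
      rfl
    · rw [← Nat.cofinite_eq_atTop]
      exact ((Face.vadd_left_injective f).comp hσ).tendsto_cofinite

theorem tendsto_floor_natCast_mul_div (x : ℝ) :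
    Tendsto (fun n : ℕ => (⌊n * x⌋ : ℝ) / n) atTop (𝓝 x) := by
  have hlow : Tendsto (fun n : ℕ => x - (n : ℝ)⁻¹) atTop (𝓝 x) := by
    simpa using (tendsto_inv_atTop_nhds_zero_nat (𝕜 := ℝ)).const_sub x
  refine tendsto_of_tendsto_of_tendsto_of_le_of_le' hlow tendsto_const_nhds ?_ ?_ <;>
    filter_upwards [eventually_gt_atTop 0] with n hn
  · rw [le_div_iff₀ (by positivity), sub_mul, inv_mul_cancel₀ (by positivity), mul_comm]
    exact (Int.sub_one_lt_floor _).le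
  · rw [div_le_iff₀ (by positivity), mul_comm]
    exact Int.floor_le _

theorem tendsto_inv_smul_pos_floor (a : EuclideanSpace ℝ (Fin 2)) :
    Tendsto (fun n : ℕ => (n : ℝ)⁻¹ • Vertex.pos (⌊n * a 0⌋, ⌊n * a 1⌋)) atTop (𝓝 a) := by
  have h : Tendsto (fun n : ℕ => ![(⌊n * a 0⌋ : ℝ) / n, (⌊n * a 1⌋ : ℝ) / n]) atTop
      (𝓝 ![a 0, a 1]) :=
    (tendsto_floor_natCast_mul_div _).matrixVecCons
     ((tendsto_floor_natCast_mul_div _).matrixVecCons tendsto_const_nhds)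
  convert ((PiLp.continuous_toLp 2 _).tendsto _).comp h using 2 with n
  · ext i
    fin_cases i <;> simp [Vertex.pos, div_eq_inv_mul]
  · ext i
    fin_cases i <;> rfl

theorem six_nsmul_mem_colorLattice (v : ℤ × ℤ) : 6 • v ∈ colorLattice :=
  ⟨⟨3 * (v.1 + v.2), by rw [Prod.smul_fst, Prod.smul_snd]; ring⟩,
    ⟨2 * v.1, by rw [Prod.smul_fst]; ring⟩⟩

theorem pos_add (v w : Vertex) : Vertex.pos (v + w) = Vertex.pos v + Vertex.pos w := by
  ext i
  fin_cases i <;> simp [Vertex.pos]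

theorem pos_nsmul (n : ℕ) (v : Vertex) : Vertex.pos (n • v) = (n : ℝ) • Vertex.pos v := by
  ext i
  fin_cases i <;> simp [Vertex.pos]

section OpenCone

variable {U : Set (EuclideanSpace ℝ (Fin 2))} (hU : IsOpen U)
  (hsmul : ∀ r : ℝ, 0 < r → ∀ x, r • x ∈ U ↔ x ∈ U)

include hU hsmul

theorem exists_colorLattice_pos_mem (hne : U.Nonempty) :
    ∃ τ : colorLattice, Vertex.pos τ ∈ U := by
  obtain ⟨a, ha⟩ := hne
  obtain ⟨n, hn, hn0⟩ := (((tendsto_inv_smul_pos_floor a).eventually_mem (hU.mem_nhds ha)).and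
    (eventually_gt_atTop 0)).exists
  rw [hsmul _ (by positivity)] at hn
  exact ⟨⟨6 • (⌊n * a 0⌋, ⌊n * a 1⌋), six_nsmul_mem_colorLattice _⟩,
    by rwa [pos_nsmul, hsmul _ (by positivity)]⟩

theorem eventually_pos_nsmul_add_sub_mem {w : Vertex} (hw : Vertex.pos w ∈ U) (v : Vertex)
    (p : EuclideanSpace ℝ (Fin 2)) :
    ∀ᶠ n : ℕ in atTop, Vertex.pos (n • w + v) - p ∈ U := by
  have hlim : Tendsto (fun n : ℕ => Vertex.pos w + (n : ℝ)⁻¹ • (Vertex.pos v - p)) atTop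
      (𝓝 (Vertex.pos w)) := by
    simpa using ((tendsto_inv_atTop_nhds_zero_nat (𝕜 := ℝ)).smul_const
      (Vertex.pos v - p)).const_add (Vertex.pos w)
  filter_upwards [hlim.eventually_mem (hU.mem_nhds hw), eventually_gt_atTop 0] with n hn hn0
  rw [← hsmul n (by positivity), smul_add, smul_inv_smul₀ (by positivity)] at hn
  rwa [pos_add, pos_nsmul, add_sub_assoc]

end OpenCone

theorem IsCone.exists_eventually_vadd_mem {Λ : Set Vertex} (hΛ : IsCone Λ) :
    ∃ τ : colorLattice, τ ≠ 0 ∧ ∀ v : Vertex, ∀ᶠ n : ℕ in atTop, n • τ +ᵥ v ∈ Λ := by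
  obtain ⟨p, a, θ, ha, hθ, hθπ, rfl⟩ := hΛ
  let U : Set (EuclideanSpace ℝ (Fin 2)) := {x | ‖x‖ * Real.cos θ < inner ℝ x a}
  have hU : IsOpen U := isOpen_lt (by fun_prop) (by fun_prop)
  have hsmul (r : ℝ) (hr : 0 < r) (x) : r • x ∈ U ↔ x ∈ U := by
    simp only [U, Set.mem_ofPred_eq, norm_smul, Real.norm_of_nonneg hr.le, inner_smul_left,
      conj_trivial, mul_assoc, mul_lt_mul_iff_right₀ hr]
  have haU : a ∈ U := by
    have hcos := Real.cos_lt_cos_of_nonneg_of_le_pi le_rfl hθπ.le hθ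
    simpa [U, real_inner_self_eq_norm_sq, ha] using hcos
  obtain ⟨τ, hτ⟩ := exists_colorLattice_pos_mem hU hsmul ⟨a, haU⟩
  refine ⟨τ, ?_, fun v => eventually_pos_nsmul_add_sub_mem hU hsmul hτ v p⟩
  rintro rfl
  have hzero : Vertex.pos 0 = 0 := by simpa using pos_nsmul 0 0
  simp [U, hzero] at hτ

theorem IsCone.exists_charge_eq {Λ : Set Vertex} (hΛ : IsCone Λ) (c : Color) :
    ∃ S : Vertex → ZMod 2, Set.EqOn S 0 Λᶜ ∧ charge S = colorCharge c := by
  obtain ⟨τ, hτ, hmem⟩ := hΛ.exists_eventually_vadd_mem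
  obtain ⟨S, σ, hS, hsyn⟩ := exists_syndrome_eq_of_eventually_vadd_mem hτ hmem (baseFace c)
  refine ⟨S, hS, ?_⟩
  calc charge S = faceCharge (σ +ᵥ baseFace c) := congrArg Submodule.Quotient.mk hsyn
    _ = colorCharge c := faceCharge_vadd σ (baseFace c)

/-- The charges that are carried by Pauli operators in every cone. -/
def localizableCharges : Submodule (ZMod 2) ChargeGroup where
  carrier := {q | ∀ Λ, IsCone Λ → ∃ S, Set.EqOn S 0 Λᶜ ∧ charge S = q}
  zero_mem' Λ _ := ⟨0, fun _ _ => rfl, map_zero charge⟩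
  add_mem' {q q'} hq hq' Λ hΛ := by
    obtain ⟨S, hS, rfl⟩ := hq Λ hΛ
    obtain ⟨S', hS', rfl⟩ := hq' Λ hΛ
    exact ⟨S + S', fun v hv => by simp [hS hv, hS' hv], map_add charge S S'⟩
  smul_mem' r q hq Λ hΛ := by
    obtain ⟨S, hS, rfl⟩ := hq Λ hΛ
    exact ⟨r • S, fun v hv => by simp [hS hv], map_smul charge r S⟩

theorem colorCharge_mem_localizableCharges (c : Color) : colorCharge c ∈ localizableCharges :=
  fun _ hΛ => hΛ.exists_charge_eq c

/-! ### Charges of representations -/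

/-- The representation `π` carries the charges `q = (q^x, q^z)` of its `σ^x` and `σ^z` parts: up to
equivalence it is `π₀ ∘ ρ` for a Pauli endomorphism `ρ` with these charges. -/
def Rep.HasCharge (π₀ : Rep.{u}) (π : Rep.{v}) (q : ChargeGroup × ChargeGroup) : Prop :=
  ∃ P : Pattern, charge.prodMap charge P = q ∧ π.Equiv (π₀.comp (pauliEndo P))

namespace Rep

variable {π₀ : Rep.{u}} (h₀ : π₀.IsGNS groundState)

include h₀

theorem IsGNS.hasCharge {π : Rep.{v}} {P : Pattern}
    (h : π.IsGNS (pullback groundState (pauliEndo P))) :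
    HasCharge π₀ π (charge.prodMap charge P) :=
  ⟨P, rfl, h₀.equiv_comp_pauliEndo h⟩

theorem HasCharge.equiv {π : Rep.{v}} {P : Pattern}
    (h : HasCharge π₀ π (charge.prodMap charge P)) : π.Equiv (π₀.comp (pauliEndo P)) := by
  obtain ⟨Q, hQ, hπ⟩ := h
  exact hπ.trans (h₀.comp_pauliEndo_equiv (congrArg Prod.fst hQ) (congrArg Prod.snd hQ))

theorem HasCharge.isSuperselectionSector {π : Rep.{v}} {q : ChargeGroup × ChargeGroup}
    (h : HasCharge π₀ π q) (hq : q ∈ localizableCharges.prod localizableCharges) :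
    IsSuperselectionSector π₀ π := by
  intro Λ hΛ
  obtain ⟨S, hS, hcS⟩ := hq.1 Λ hΛ
  obtain ⟨T, hT, hcT⟩ := hq.2 Λ hΛ
  obtain rfl : charge.prodMap charge (S, T) = q := Prod.ext hcS hcT
  obtain ⟨U, hU⟩ := h.equiv h₀
  refine ⟨U, fun a ha x => (hU a x).trans ?_⟩
  change π₀.hom (pauliEndo (S, T) a) (U x) = π₀.hom a (U x)
  rw [pauliEndo_apply_eq_self hS hT ha]

end Rep

/-- The charges of the sector `π^{ck}`. -/
def bosonCharge (c : Color) (k : PauliType) : ChargeGroup × ChargeGroup :=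
  (k.xPart • colorCharge c, k.zPart • colorCharge c)

theorem bosonCharge_x (c : Color) : bosonCharge c .x = (colorCharge c, 0) := by
  simp [bosonCharge, PauliType.xPart, PauliType.zPart]

theorem bosonCharge_y (c : Color) : bosonCharge c .y = (colorCharge c, colorCharge c) := by
  simp [bosonCharge, PauliType.xPart, PauliType.zPart]

theorem bosonCharge_z (c : Color) : bosonCharge c .z = (0, colorCharge c) := by
  simp [bosonCharge, PauliType.xPart, PauliType.zPart]

theorem bosonCharge_mem_localizableCharges (c : Color) (k : PauliType) :
    bosonCharge c k ∈ localizableCharges.prod localizableCharges :=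
  ⟨Submodule.smul_mem _ _ (colorCharge_mem_localizableCharges c),
    Submodule.smul_mem _ _ (colorCharge_mem_localizableCharges c)⟩

theorem HalfInfiniteString.charge_pattern {c : Color} (γ : HalfInfiniteString c) (k : PauliType) :
    charge.prodMap charge (k.pattern (chain (Set.range γ.vert))) = bosonCharge c k := by
  simp only [PauliType.pattern, LinearMap.prodMap_apply, map_smul, γ.charge_chain_range,
    bosonCharge]

/-- The charges of the fermions. They are the six ordered pairs of different colours. -/
def fermionCharge : Fermion → ChargeGroup × ChargeGroup
  | .f1 => (colorCharge .r, colorCharge .b)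
  | .f2 => (colorCharge .b, colorCharge .r)
  | .f3 => (colorCharge .g, colorCharge .r)
  | .f4 => (colorCharge .g, colorCharge .b)
  | .f5 => (colorCharge .b, colorCharge .g)
  | .f6 => (colorCharge .r, colorCharge .g)

theorem fermionCharge_mem_localizableCharges (j : Fermion) :
    fermionCharge j ∈ localizableCharges.prod localizableCharges := by
  cases j <;> exact ⟨colorCharge_mem_localizableCharges _, colorCharge_mem_localizableCharges _⟩

theorem colorCharge_r_add_g : colorCharge .r + colorCharge .g = colorCharge .b := by
  rw [← sub_eq_zero, ZModModule.sub_eq_add, sum_colorCharge_eq_zero]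

theorem colorCharge_g_add_b : colorCharge .g + colorCharge .b = colorCharge .r := by
  rw [← sub_eq_zero, ZModModule.sub_eq_add, ← sum_colorCharge_eq_zero]
  abel

theorem colorCharge_b_add_r : colorCharge .b + colorCharge .r = colorCharge .g := by
  rw [← sub_eq_zero, ZModModule.sub_eq_add, ← sum_colorCharge_eq_zero]
  abel

theorem tensor_endo_eq_pauliEndo {c c' : Color} (γ : HalfInfiniteString c) (k : PauliType)
    (γ' : HalfInfiniteString c') (k' : PauliType) :
    tensor (γ.endo k) (γ'.endo k') = pauliEndo
      (k.pattern (chain (Set.range γ.vert)) + k'.pattern (chain (Set.range γ'.vert))) := by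
  rw [tensor, γ.endo_eq_pauliEndo, γ'.endo_eq_pauliEndo, pauliEndo_add]

section

variable {π₀ : Rep.{u}} (h₀ : π₀.IsGNS groundState)

include h₀

theorem IsBosonSector.hasCharge {π : Rep.{v}} {c : Color} {k : PauliType}
    (h : IsBosonSector c k π) : π₀.HasCharge π (bosonCharge c k) := by
  obtain ⟨γ, -, hγ⟩ := h
  rw [γ.endo_eq_pauliEndo] at hγ
  exact γ.charge_pattern k ▸ Rep.IsGNS.hasCharge h₀ hγ

theorem hasCharge_of_isGNS_pairState {π : Rep.{v}} {c c' : Color} {k k' : PauliType}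
    (h : π.IsGNS (pairState c k c' k')) :
    π₀.HasCharge π (bosonCharge c k + bosonCharge c' k') := by
  change π.IsGNS (pullback groundState (tensor _ _)) at h
  rw [tensor_endo_eq_pauliEndo] at h
  simpa only [map_add, HalfInfiniteString.charge_pattern] using Rep.IsGNS.hasCharge h₀ h

theorem hasCharge_of_isGNS_fermionState {π : Rep.{v}} {j : Fermion}
    (h : π.IsGNS (fermionState j)) : π₀.HasCharge π (fermionCharge j) := by
  cases j <;>
    simpa [fermionCharge, bosonCharge_x, bosonCharge_y, bosonCharge_z, colorCharge_r_add_g,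
      colorCharge_g_add_b, add_comm (colorCharge .b) (colorCharge .g)]
      using hasCharge_of_isGNS_pairState h₀ h

theorem Rep.HasCharge.isFusion {B : Color → PauliType → Rep.{v}}
    (hB : ∀ c k, IsBosonSector c k (B c k)) {π : Rep.{w}} {q : ChargeGroup × ChargeGroup}
    (h : π₀.HasCharge π q) {c c' : Color} {k k' : PauliType}
    (hq : q = bosonCharge c k + bosonCharge c' k') : IsFusion π₀ B π c k c' k' := by
  have hboson (c : Color) (k : PauliType) (γ : HalfInfiniteString c) :
      (B c k).Equiv (π₀.comp (γ.endo k)) := by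
    rw [γ.endo_eq_pauliEndo]
    exact Rep.HasCharge.equiv h₀ (γ.charge_pattern k ▸ (hB c k).hasCharge h₀)
  refine fun γ _ γ' _ => ⟨hboson c k γ, hboson c' k' γ', ?_⟩
  rw [tensor_endo_eq_pauliEndo]
  refine Rep.HasCharge.equiv h₀ ?_
  rwa [map_add, γ.charge_pattern, γ'.charge_pattern, ← hq]

end

end ColorCode

end

theorem mainTheorem7 (π₀ : Rep.{u}) (h₀ : π₀.IsGNS groundState)
    (B : Color → PauliType → Rep.{v}) (hB : ∀ c k, IsBosonSector c k (B c k))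
    (F : Fermion → Rep.{w}) (hF : ∀ j, (F j).IsGNS (fermionState j)) :
    ((∀ c k, Rep.IsSuperselectionSector π₀ (B c k)) ∧
      ∀ j, Rep.IsSuperselectionSector π₀ (F j)) ∧
    (IsFusion π₀ B (F .f1) .r .x .b .z ∧
      IsFusion π₀ B (F .f1) .r .y .g .z ∧
      IsFusion π₀ B (F .f1) .g .x .b .y) ∧
    (IsFusion π₀ B (F .f2) .r .z .b .x ∧
      IsFusion π₀ B (F .f2) .r .y .g .x ∧
      IsFusion π₀ B (F .f2) .g .z .b .y) ∧
    (IsFusion π₀ B (F .f3) .b .z .g .y ∧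
      IsFusion π₀ B (F .f3) .g .x .r .z ∧
      IsFusion π₀ B (F .f3) .b .x .r .y) ∧
    (IsFusion π₀ B (F .f4) .r .z .g .y ∧
      IsFusion π₀ B (F .f4) .g .x .b .z ∧
      IsFusion π₀ B (F .f4) .r .x .b .y) ∧
    (IsFusion π₀ B (F .f5) .r .x .g .y ∧
      IsFusion π₀ B (F .f5) .b .x .g .z ∧
      IsFusion π₀ B (F .f5) .b .y .r .z) ∧
    (IsFusion π₀ B (F .f6) .b .x .g .y ∧
      IsFusion π₀ B (F .f6) .r .x .g .z ∧
      IsFusion π₀ B (F .f6) .r .y .b .z) := by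
  have hfermion (j : Fermion) := hasCharge_of_isGNS_fermionState h₀ (hF j)
  refine ⟨⟨fun c k => ?_, fun j => ?_⟩, ⟨?_, ?_, ?_⟩, ⟨?_, ?_, ?_⟩, ⟨?_, ?_, ?_⟩, ⟨?_, ?_, ?_⟩,
    ⟨?_, ?_, ?_⟩, ⟨?_, ?_, ?_⟩⟩
  · exact ((hB c k).hasCharge h₀).isSuperselectionSector h₀ (bosonCharge_mem_localizableCharges c k)
  · exact (hfermion j).isSuperselectionSector h₀ (fermionCharge_mem_localizableCharges j)
  all_goals
    refine (hfermion _).isFusion h₀ hB ?_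
    simp [fermionCharge, bosonCharge_x, bosonCharge_y, bosonCharge_z, colorCharge_r_add_g,
      colorCharge_g_add_b, colorCharge_b_add_r, add_comm (colorCharge .b) (colorCharge .g),
      add_comm (colorCharge .r) (colorCharge .b)]
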